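/- Let $f:(0,\infty)\to\mathbb R$ be twice continuously differentiable with $f,f',f''>0$, and assume that there are constants $c_1\ge 1/2$ and $c_2>0$ such that $c_1f''(x)\le f''(y)\le c_2f''(x)$ whenever $0<x\le y\le 2x$. Then there is a constant $C>0$, depending only on $f$, such that the following holds. For every real $A_0\ge 2$ with $f'(A_0)\ge 1$, every function $\varphi:\mathbb N\to\mathbb C$ (where $\mathbb N=\{0,1,2,\dots\}$) with $|\varphi(n)|\le 1$ for all $n$, every integer $A\ge A_0$ and every real $z>0$, $$\frac1A\left|\sum_{A<n\le 2A}\varphi(\lfloor f(n)\rfloor)-\sum_{f(A)<m\le f(2A)}\varphi(m)\,(f^{-1})'(m)\right|\le C\left(\frac{f''(A)}{f'(A)^2}\,z^2+f'(A)(\log A)^3J(A,z)\right),$$ where, with $\mathrm e(t)=e^{2\pi i t}$ and with $n$, $m$ running over integers, $$J(A,z)=\int_0^1\ \sup_{f(A)<x\le f(2A)}\ \frac1z\left|\sum_{x<m\le x+z}\varphi(m)\,\mathrm e(m\theta)\right|\,d\theta .$$ -/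

import Mathlib

open scoped BigOperators

noncomputable section

namespace PiatetskiShapiro

/-- The natural numbers `m` with `a < m ≤ b`, for real `0 ≤ a` and `0 ≤ b`. -/
def intervalNat (a b : ℝ) : Finset ℕ := Finset.Ioc ⌊a⌋₊ ⌊b⌋₊

theorem mem_intervalNat {a b : ℝ} (ha : 0 ≤ a) (hb : 0 ≤ b) (m : ℕ) :
    m ∈ intervalNat a b ↔ a < m ∧ (m : ℝ) ≤ b := by
  simp [intervalNat, Nat.floor_lt ha, Nat.le_floor_iff hb]

/-- `e(x) = exp(2πix)`. -/
def e (x : ℝ) : ℂ := Complex.exp (2 * Real.pi * Complex.I * x)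

/-- The inverse function of `f : ℝ⁺ → ℝ`: for `y` in `f(ℝ⁺)` it picks an `x > 0` with `f x = y`,
which is unique when `f` is strictly increasing on the positive reals. -/
def inv (f : ℝ → ℝ) : ℝ → ℝ := Function.invFunOn f (Set.Ioi 0)

theorem inv_apply {f : ℝ → ℝ} (hf : Set.InjOn f (Set.Ioi 0)) {x : ℝ} (hx : 0 < x) :
    inv f (f x) = x :=
  hf.leftInvOn_invFunOn hx

/-- `J(A, z) = ∫₀¹ sup_{f(A) < x ≤ f(2A)} (1/z) |∑_{x < m ≤ x+z} φ(m) e(mθ)| dθ`.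
For `f` positive and strictly increasing on the positive reals, `A > 0`, `z > 0` and bounded `φ`,
the supremum is that of a non-empty bounded set, and it is a maximum of finitely many continuous
functions of `θ`. -/
def J (f : ℝ → ℝ) (φ : ℕ → ℂ) (A z : ℝ) : ℝ :=
  ∫ θ in (0 : ℝ)..1, ⨆ x : Set.Ioc (f A) (f (2 * A)),
    1 / z * ‖∑ m ∈ intervalNat (x : ℝ) (x + z), φ m * e (m * θ)‖

/-- The function `f` (of which only the values on the positive reals matter) is `C²` on `ℝ⁺`,
`f`, `f'`, `f''` are positive there, and for some `c₁ ≥ 1/2` and `c₂ > 0` one has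
`c₁ f''(x) ≤ f''(y) ≤ c₂ f''(x)` whenever `0 < x ≤ y ≤ 2x`. -/
structure Admissible (f : ℝ → ℝ) : Prop where
  contDiffOn : ContDiffOn ℝ 2 f (Set.Ioi 0)
  pos : ∀ x, 0 < x → 0 < f x
  deriv_pos : ∀ x, 0 < x → 0 < deriv f x
  deriv_deriv_pos : ∀ x, 0 < x → 0 < deriv (deriv f) x
  doubling : ∃ c₁ c₂ : ℝ, 1 / 2 ≤ c₁ ∧ 0 < c₂ ∧ ∀ x y, 0 < x → x ≤ y → y ≤ 2 * x →
    c₁ * deriv (deriv f) x ≤ deriv (deriv f) y ∧ deriv (deriv f) y ≤ c₂ * deriv (deriv f) x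

end PiatetskiShapiro

end

/-!
Write `g` for the inverse function of `f`. An integer `m` is of the form `⌊f(n)⌋` exactly when
there is an integer in `[g(m), g(m+1))`, so the number of such `n` is `⌈g(m+1)⌉ - ⌈g(m)⌉`
(`Admissible.hits_eq`), while the second sum counts `m` with weight `g'(m)`.

On a window `x < m ≤ x + z` that starts at `x = f(t)`, the function `g` is replaced by its tangent,
of slope `1 / f'(t)`; the error is `O(f''(A) z² / f'(A)³)` (`Doubling.linearization`). The sawtooth
functions that express the ceilings of a linear phase are smoothed at the scale
`η = O(f''(A) z² / f'(A)³) + 1/z`. The smoothed sawtooth, as well as the tent that bounds the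
smoothing error, are difference quotients of the periodic Bernoulli function `bern`
(`abs_ceil_sub_le`), and the absolutely convergent Fourier series of `bern` bounds the window sum by
the window suprema at the frequencies `h / f'(t)`, with weight `min(1/h, 1/f'(A))`
(`norm_sum_ddiff_bern_le`, `Doubling.norm_sum_window_le`).

Now `x` is averaged over the whole range. As `f'' > 0`, the frequency `h / f'(g(x))` moves at a speed
of order `h f''(A) / f'(A)³` when `x` does, so that this average becomes an integral over the
frequency, covered by `O(1 + h A f''(A) / f'(A)²)` periods (`Doubling.integral_comp_slope_le`). The
condition `c₁ ≥ 1/2` gives `f'(A) = O(A f''(A) log A)` (`Doubling.exists_deriv_le_log_mul`), which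
costs one logarithm; the sum over `h` costs a second one. The smoothing error involves the window
suprema of the constant function `1`, whose integral is `O(log z / z)`
(`integral_windowSup_one_le`). This is absorbed at the cost of the third logarithm, because
`J(A, z) ≥ M / z`, where `M` is the maximum of `|φ|` on the range
(`norm_div_le_integral_windowSup`).

When the bound of the theorem is not small compared with `M`, it follows from the trivial estimate
(`Doubling.norm_discrepancy_le`).
-/

open scoped BigOperators

namespace PiatetskiShapiro

/-! ### The periodic Bernoulli function -/

/-- The second Bernoulli polynomial `t² - t + 1/6`, made `1`-periodic. -/
noncomputable def bern (t : ℝ) : ℝ := Int.fract t ^ 2 - Int.fract t + 1 / 6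

theorem bern_eq {t : ℝ} {k : ℤ} (h0 : k ≤ t) (h1 : t < k + 1) :
    bern t = (t - k) ^ 2 - (t - k) + 1 / 6 := by
  have : ⌊t⌋ = k := Int.floor_eq_iff.2 ⟨h0, h1⟩
  rw [bern, Int.fract, this]

/-- `bern` is the lower envelope of the integer translates of its parabola, so that any translate
gives an upper bound. -/
theorem bern_le (t : ℝ) (k : ℤ) : bern t ≤ (t - k) ^ 2 - (t - k) + 1 / 6 := by
  have h0 := Int.floor_le t
  have h1 := Int.lt_floor_add_one t
  rw [bern_eq h0 h1]
  rcases lt_trichotomy ⌊t⌋ k with h | h | h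
  · have : (⌊t⌋ : ℝ) + 1 ≤ k := by exact_mod_cast h
    nlinarith
  · rw [h]
  · have : (k : ℝ) + 1 ≤ ⌊t⌋ := by exact_mod_cast h
    nlinarith

theorem abs_bern_add_sub_le {η : ℝ} (hη : 0 < η) (t : ℝ) :
    |bern (t + η) - bern t| ≤ η * (1 + η) := by
  have h0 := Int.floor_le t
  have h1 := Int.lt_floor_add_one t
  have h2 := Int.floor_le (t + η)
  have h3 := Int.lt_floor_add_one (t + η)
  have a1 := bern_le (t + η) ⌊t⌋
  have a2 := bern_le t ⌊t + η⌋
  rw [bern_eq h0 h1] at *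
  rw [bern_eq h2 h3] at *
  rw [abs_le]
  constructor <;> nlinarith

/-- The double difference `F(t+p+q) - F(t+p) - F(t+q) + F(t)`. -/
def ddiff {R : Type*} [AddCommGroup R] (F : ℝ → R) (p q t : ℝ) : R :=
  F (t + p + q) - F (t + p) - F (t + q) + F t

/-- The sawtooth `{t} - 1/2` averaged over `[t, t + η]`. -/
noncomputable def saw (η t : ℝ) : ℝ := (bern (t + η) - bern t) / (2 * η)

/-- For small `η` this is the `1`-periodic tent `η⁻¹ max(0, 2η - dist(t, ℤ))`, written as a second
difference of `bern`. -/
noncomputable def tent (η t : ℝ) : ℝ := 4 * η + ddiff bern (2 * η) (-(2 * η)) t / (2 * η)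

theorem saw_sub_saw (η p t : ℝ) : saw η (t + p) - saw η t = ddiff bern p η t / (2 * η) := by
  rw [saw, saw, ddiff]; ring

theorem tent_nonneg {η : ℝ} (hη : 0 < η) (t : ℝ) : 0 ≤ tent η t := by
  have h0 := Int.floor_le t
  have h1 := Int.lt_floor_add_one t
  have a1 := bern_le (t + 2 * η) ⌊t⌋
  have a2 := bern_le (t + -(2 * η)) ⌊t⌋
  have a3 := bern_eq h0 h1
  have : tent η t = (8 * η ^ 2 + ddiff bern (2 * η) (-(2 * η)) t) / (2 * η) := by
    rw [tent]; field_simp; ring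
  rw [this, ddiff, show t + 2 * η + -(2 * η) = t by ring]
  apply div_nonneg _ (by positivity)
  nlinarith

theorem one_le_tent {η : ℝ} (hη : 0 < η) {t : ℝ} (ht : Int.fract t ≤ η) : 1 ≤ tent η t := by
  have h0 := Int.floor_le t
  have h1 := Int.lt_floor_add_one t
  have a1 := bern_le (t + 2 * η) ⌊t⌋
  have a2 := bern_le (t + -(2 * η)) (⌊t⌋ - 1)
  push_cast at a2
  have a3 := bern_eq h0 h1
  have : tent η t = (8 * η ^ 2 + ddiff bern (2 * η) (-(2 * η)) t) / (2 * η) := by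
    rw [tent]; field_simp; ring
  rw [this, ddiff, show t + 2 * η + -(2 * η) = t by ring, le_div_iff₀ (by positivity)]
  have : t - ⌊t⌋ ≤ η := ht
  nlinarith

/-- If `y` lies in `[l - η, l]`, then `⌈y⌉ = y + {-y} ≈ l + 1/2 + saw η (-l)`, except when `l` is
just above an integer, and there the tent accounts for the difference. -/
theorem abs_ceil_sub_le {η l y : ℝ} (hη : 0 < η) (hη1 : η ≤ 1 / 2) (h0 : l - η ≤ y) (h1 : y ≤ l) :
    |(⌈y⌉ : ℝ) - (l + 1 / 2 + saw η (-l))| ≤ η + 2 * tent η l := by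
  have htn := tent_nonneg hη l
  by_cases hl : Int.fract l ≤ η
  · have ht := one_le_tent hη hl
    have hs : |saw η (-l)| ≤ (1 + η) / 2 := by
      rw [saw, abs_div, abs_of_pos (show 0 < 2 * η by positivity), div_le_iff₀ (by positivity)]
      have := abs_bern_add_sub_le hη (-l)
      linarith
    have c0 := Int.le_ceil y
    have c1 := Int.ceil_lt_add_one y
    rw [abs_le] at hs ⊢
    constructor <;> linarith
  · push Not at hl
    have f0 := Int.floor_le l
    have f1 := Int.lt_floor_add_one l
    have hl' : η < l - ⌊l⌋ := hl
    have hc : ⌈y⌉ = ⌊l⌋ + 1 := by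
      rw [Int.ceil_eq_iff]; push_cast; constructor <;> linarith
    have b1 : bern (-l) = (-l - ((-⌊l⌋ - 1 : ℤ) : ℝ)) ^ 2 - (-l - ((-⌊l⌋ - 1 : ℤ) : ℝ)) + 1 / 6 :=
      bern_eq (by push_cast; linarith) (by push_cast; linarith)
    have b2 : bern (-l + η) =
        (-l + η - ((-⌊l⌋ - 1 : ℤ) : ℝ)) ^ 2 - (-l + η - ((-⌊l⌋ - 1 : ℤ) : ℝ)) + 1 / 6 :=
      bern_eq (by push_cast; linarith) (by push_cast; linarith)
    have : (⌈y⌉ : ℝ) - (l + 1 / 2 + saw η (-l)) = - η / 2 := by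
      rw [saw, b1, b2, hc]; push_cast; field_simp; ring
    rw [this, abs_le]
    constructor <;> linarith

/-! ### Truncated Fourier series -/

theorem e_add (x y : ℝ) : e (x + y) = e x * e y := by
  rw [e, e, e, ← Complex.exp_add]; push_cast; ring_nf

theorem e_eq (x : ℝ) : e x = Complex.exp (Complex.I * ((2 * Real.pi * x : ℝ) : ℂ)) := by
  rw [e]; push_cast; ring_nf

@[simp] theorem norm_e (x : ℝ) : ‖e x‖ = 1 := by
  rw [e_eq, mul_comm]; exact Complex.norm_exp_ofReal_mul_I _

theorem e_nat (n : ℕ) : e n = 1 := by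
  rw [e, Complex.exp_eq_one_iff]
  exact ⟨n, by push_cast; ring⟩

theorem norm_e_sub_one_le (x : ℝ) : ‖e x - 1‖ ≤ 2 * Real.pi * |x| := by
  rw [e_eq]
  refine Real.norm_exp_I_mul_ofReal_sub_one_le.trans_eq ?_
  rw [Real.norm_eq_abs, abs_mul, abs_of_pos Real.two_pi_pos]

theorem norm_e_sub_one_le_two (x : ℝ) : ‖e x - 1‖ ≤ 2 :=
  (norm_sub_le _ _).trans_eq (by rw [norm_e, norm_one]; norm_num)

theorem norm_e_sub_e_le (x y : ℝ) : ‖e x - e y‖ ≤ 2 * Real.pi * |x - y| := by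
  have : e x - e y = e y * (e (x - y) - 1) := by
    rw [mul_sub, ← e_add, mul_one]; ring_nf
  rw [this, norm_mul, norm_e, one_mul]
  exact norm_e_sub_one_le _

theorem cos_eq_e (x : ℝ) : ((Real.cos (2 * Real.pi * x) : ℝ) : ℂ) = (e x + e (-x)) / 2 := by
  rw [e, e, Complex.ofReal_cos, Complex.cos]; push_cast; ring_nf

/-- The Fourier series of `bern`, truncated at frequency `N`. -/
noncomputable def bernSum (N : ℕ) (t : ℝ) : ℂ :=
  ∑ h ∈ Finset.Icc 1 N, ((1 / (2 * Real.pi ^ 2 * h ^ 2) : ℝ) : ℂ) * (e (h * t) + e (-(h * t)))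

theorem hasSum_bern (t : ℝ) :
    HasSum (fun n : ℕ => 1 / (n : ℝ) ^ 2 * Real.cos (2 * Real.pi * n * t))
      (Real.pi ^ 2 * bern t) := by
  have h := hasSum_one_div_nat_pow_mul_cos (k := 1) one_ne_zero (x := Int.fract t)
    ⟨Int.fract_nonneg t, (Int.fract_lt_one t).le⟩
  have hv : (Polynomial.map (algebraMap ℚ ℝ) (Polynomial.bernoulli 2)).eval (Int.fract t)
      = bern t := by
    have : Polynomial.bernoulli 2 = Polynomial.X ^ 2 - Polynomial.X + Polynomial.C (1 / 6 : ℚ) := by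
      simp only [Polynomial.bernoulli, Finset.sum_range_succ, Finset.range_zero, Finset.sum_empty,
        zero_add, bernoulli_zero, bernoulli_one, bernoulli_two, ← Polynomial.C_mul_X_pow_eq_monomial]
      norm_num [Nat.choose]
      ring
    rw [this, bern]; simp
  rw [show 2 * 1 = 2 from rfl, hv] at h
  convert h using 1
  · ext n
    congr 1
    have : 2 * Real.pi * n * t = 2 * Real.pi * n * Int.fract t + ((n * ⌊t⌋ : ℤ) : ℝ) * (2 * Real.pi) := by
      push_cast; rw [Int.fract]; ring
    rw [this, Real.cos_add_int_mul_two_pi]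
  · simp [Nat.factorial]; ring_nf; simp

theorem norm_bern_sub_bernSum_le {N : ℕ} (hN : 1 ≤ N) (t : ℝ) :
    ‖(bern t : ℂ) - bernSum N t‖ ≤ 1 / N := by
  set a : ℕ → ℝ := fun n => 1 / (n : ℝ) ^ 2 * Real.cos (2 * Real.pi * n * t) with ha
  have hS : bernSum N t = ((1 / Real.pi ^ 2 * ∑ n ∈ Finset.range (N + 1), a n : ℝ) : ℂ) := by
    have h0 : a 0 = 0 := by simp [ha]
    rw [Finset.range_eq_Ico, Finset.sum_eq_sum_Ico_succ_bot (by omega), h0, zero_add, bernSum,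
      Finset.mul_sum]
    push_cast
    refine Finset.sum_congr (by ext; simp) fun h hh => ?_
    have := cos_eq_e (h * t)
    rw [ha]
    simp only
    rw [show 2 * Real.pi * (h : ℝ) * t = 2 * Real.pi * (h * t) by ring]
    push_cast at this ⊢
    rw [this]
    have : (h : ℂ) ≠ 0 := by
      have := (Finset.mem_Icc.1 hh).1
      exact_mod_cast (by omega : h ≠ 0)
    have hp : (Real.pi : ℂ) ≠ 0 := by exact_mod_cast Real.pi_ne_zero
    field_simp
  have htail : |Real.pi ^ 2 * bern t - ∑ n ∈ Finset.range (N + 1), a n| ≤ 1 / N := by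
    have ht : Filter.Tendsto (fun K => |∑ n ∈ Finset.range (K + 1), a n -
        ∑ n ∈ Finset.range (N + 1), a n|) Filter.atTop
        (nhds |Real.pi ^ 2 * bern t - ∑ n ∈ Finset.range (N + 1), a n|) :=
      ((((hasSum_bern t).tendsto_sum_nat.comp (Filter.tendsto_add_atTop_nat 1))).sub_const _).abs
    refine le_of_tendsto ht ?_
    filter_upwards [Filter.eventually_ge_atTop N] with K hK
    rw [← Finset.sum_Ico_eq_sub _ (by omega : N + 1 ≤ K + 1)]
    refine (Finset.abs_sum_le_sum_abs _ _).trans ?_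
    have : Finset.Ico (N + 1) (K + 1) = Finset.Ioc N K := by ext; simp
    rw [this]
    refine (Finset.sum_le_sum (g := fun i : ℕ => ((i : ℝ) ^ 2)⁻¹) fun i _ => ?_).trans
      ((sum_Ioc_inv_sq_le_sub (by omega) hK).trans ?_)
    · rw [ha, abs_mul, one_div, abs_of_nonneg (by positivity : (0 : ℝ) ≤ ((i : ℝ) ^ 2)⁻¹)]
      exact mul_le_of_le_one_right (by positivity) (Real.abs_cos_le_one _)
    · rw [one_div]; linarith [show (0 : ℝ) ≤ (K : ℝ)⁻¹ by positivity]
  rw [hS, ← Complex.ofReal_sub, Complex.norm_real, Real.norm_eq_abs]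
  have hp : 1 ≤ Real.pi ^ 2 := by nlinarith [Real.pi_gt_three]
  have : bern t - 1 / Real.pi ^ 2 * ∑ n ∈ Finset.range (N + 1), a n =
      (Real.pi ^ 2 * bern t - ∑ n ∈ Finset.range (N + 1), a n) / Real.pi ^ 2 := by
    field_simp
  rw [this, abs_div, abs_of_pos (by positivity : 0 < Real.pi ^ 2)]
  exact (div_le_self (abs_nonneg _) hp).trans htail

/-- Exponential sum with coefficients `ψ` over the finite set `W`. -/
noncomputable def expSum (ψ : ℕ → ℂ) (W : Finset ℕ) (θ : ℝ) : ℂ := ∑ m ∈ W, ψ m * e (m * θ)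

theorem ddiff_e (h p q t : ℝ) :
    ddiff (fun s => e (h * s)) p q t = e (h * t) * (e (h * p) - 1) * (e (h * q) - 1) := by
  simp only [ddiff, mul_add, e_add]; ring

/-- Twisting `ψ` by the `h`-th harmonic of a linear phase and taking a double difference costs a
factor `|e(hp) - 1| |e(hq) - 1|`. -/
theorem norm_sum_ddiff_e_le (ψ : ℕ → ℂ) (W : Finset ℕ) (lam β p q h : ℝ) (hh : 0 < |h|) :
    1 / (2 * Real.pi ^ 2 * h ^ 2) * ‖∑ m ∈ W, ψ m * ddiff (fun s => e (h * s)) p q (lam * m + β)‖ ≤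
      2 * |q| * min (1 / |h|) |p| * ‖expSum ψ W (h * lam)‖ := by
  have : ∑ m ∈ W, ψ m * ddiff (fun s => e (h * s)) p q (lam * m + β) =
      (e (h * β) * (e (h * p) - 1) * (e (h * q) - 1)) * expSum ψ W (h * lam) := by
    rw [expSum, Finset.mul_sum]
    refine Finset.sum_congr rfl fun m _ => ?_
    rw [ddiff_e, show h * (lam * m + β) = h * β + m * (h * lam) by ring, e_add]; ring
  rw [this, norm_mul, norm_mul, norm_mul, norm_e, one_mul, ← mul_assoc]
  refine mul_le_mul_of_nonneg_right ?_ (norm_nonneg _)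
  have hpi := Real.pi_gt_three
  have q1 := norm_e_sub_one_le (h * q)
  have p1 := norm_e_sub_one_le (h * p)
  have p2 := norm_e_sub_one_le_two (h * p)
  rw [abs_mul] at q1 p1
  have h2 : h ^ 2 = |h| ^ 2 := (sq_abs h).symm
  rw [h2]
  set H := |h|
  set Q := ‖e (h * q) - 1‖
  set P := ‖e (h * p) - 1‖
  have hP : 0 ≤ P := norm_nonneg _
  have hPm : P ≤ 2 * Real.pi * H * min (1 / H) |p| := by
    rw [mul_min_of_nonneg _ _ (by positivity)]
    refine le_min ?_ (by linarith)
    rw [mul_assoc, mul_one_div_cancel hh.ne']; linarith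
  calc 1 / (2 * Real.pi ^ 2 * H ^ 2) * (P * Q)
      ≤ 1 / (2 * Real.pi ^ 2 * H ^ 2) *
        ((2 * Real.pi * H * min (1 / H) |p|) * (2 * Real.pi * (H * |q|))) := by gcongr
    _ = 2 * |q| * min (1 / H) |p| := by field_simp

/-- A double difference of `bern` along a linear phase, summed with coefficients `ψ`, is
controlled by the exponential sums of `ψ` at the multiples of the slope. -/
theorem norm_sum_ddiff_bern_le {ψ : ℕ → ℂ} {W : Finset ℕ} {M : ℝ} (hψ : ∀ m ∈ W, ‖ψ m‖ ≤ M)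
    {N : ℕ} (hN : 1 ≤ N) (lam β p q : ℝ) :
    ‖∑ m ∈ W, ψ m * (ddiff bern p q (lam * m + β) : ℝ)‖ ≤
      4 / N * (M * W.card) + 2 * |q| * ∑ h ∈ Finset.Icc 1 N, min (1 / (h : ℝ)) |p| *
        (‖expSum ψ W (h * lam)‖ + ‖expSum ψ W (-(h * lam))‖) := by
  have hsplit : ∑ m ∈ W, ψ m * (ddiff bern p q (lam * m + β) : ℝ) =
      ∑ m ∈ W, ψ m * ((ddiff bern p q (lam * m + β) : ℝ) - ddiff (bernSum N) p q (lam * m + β)) +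
      ∑ m ∈ W, ψ m * ddiff (bernSum N) p q (lam * m + β) := by
    rw [← Finset.sum_add_distrib]; exact Finset.sum_congr rfl fun m _ => by ring
  have hdd : ∀ t, ‖((ddiff bern p q t : ℝ) : ℂ) - ddiff (bernSum N) p q t‖ ≤ 4 / N := by
    intro t
    have e1 := norm_bern_sub_bernSum_le hN (t + p + q)
    have e2 := norm_bern_sub_bernSum_le hN (t + p)
    have e3 := norm_bern_sub_bernSum_le hN (t + q)
    have e4 := norm_bern_sub_bernSum_le hN t
    have : ((ddiff bern p q t : ℝ) : ℂ) - ddiff (bernSum N) p q t =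
      ((bern (t + p + q) : ℂ) - bernSum N (t + p + q)) - ((bern (t + p) : ℂ) - bernSum N (t + p))
      - ((bern (t + q) : ℂ) - bernSum N (t + q)) + ((bern t : ℂ) - bernSum N t) := by
      simp only [ddiff]; push_cast; ring
    rw [this]
    refine (norm_add_le _ _).trans ?_
    refine (add_le_add ((norm_sub_le _ _).trans (add_le_add ((norm_sub_le _ _).trans
      (add_le_add e1 e2)) e3)) e4).trans_eq ?_
    ring
  rw [hsplit]
  refine (norm_add_le _ _).trans (add_le_add ?_ ?_)
  · refine (norm_sum_le _ _).trans ?_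
    refine (Finset.sum_le_sum (g := fun _ => M * (4 / N)) fun m hm => ?_).trans_eq ?_
    · rw [norm_mul]
      exact mul_le_mul (hψ m hm) (hdd _) (norm_nonneg _) ((norm_nonneg _).trans (hψ m hm))
    · rw [Finset.sum_const, nsmul_eq_mul]; ring
  · have : ∑ m ∈ W, ψ m * ddiff (bernSum N) p q (lam * m + β) =
        ∑ h ∈ Finset.Icc 1 N, ((1 / (2 * Real.pi ^ 2 * h ^ 2) : ℝ) : ℂ) *
          (∑ m ∈ W, ψ m * ddiff (fun s => e (h * s)) p q (lam * m + β) +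
           ∑ m ∈ W, ψ m * ddiff (fun s => e (-h * s)) p q (lam * m + β)) := by
      simp only [ddiff, bernSum, Finset.mul_sum, ← Finset.sum_add_distrib, ← Finset.sum_sub_distrib]
      rw [Finset.sum_comm]
      refine Finset.sum_congr rfl fun h _ => Finset.sum_congr rfl fun m _ => ?_
      simp only [neg_mul]; ring
    rw [this, Finset.mul_sum]
    refine (norm_sum_le _ _).trans (Finset.sum_le_sum fun h hh => ?_)
    have hh0 : (0 : ℝ) < h := by exact_mod_cast (Finset.mem_Icc.1 hh).1
    have k1 := norm_sum_ddiff_e_le ψ W lam β p q h (by positivity)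
    have k2 := norm_sum_ddiff_e_le ψ W lam β p q (-h) (by rw [abs_neg]; positivity)
    rw [abs_neg, neg_sq, neg_mul] at k2
    rw [abs_of_pos hh0] at k1 k2
    rw [norm_mul, Complex.norm_real, Real.norm_eq_abs, abs_of_nonneg (by positivity)]
    refine (mul_le_mul_of_nonneg_left (norm_add_le _ _) (by positivity)).trans ?_
    rw [mul_add]
    refine (add_le_add k1 k2).trans_eq ?_
    ring

/-! ### Suprema of exponential sums over windows -/

theorem card_intervalNat_le {x z : ℝ} (hx : 0 ≤ x) (hz : 0 ≤ z) :
    ((intervalNat x (x + z)).card : ℝ) ≤ z + 1 := by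
  have hle : ⌊x⌋₊ ≤ ⌊x + z⌋₊ := Nat.floor_mono (by linarith)
  rw [intervalNat, Nat.card_Ioc, Nat.cast_sub hle]
  have := Nat.floor_le (by linarith : 0 ≤ x + z)
  have := Nat.lt_floor_add_one x
  linarith

/-- The supremum over `a < x ≤ b` of `z⁻¹ |∑_{x < m ≤ x+z} φ(m) e(mθ)|`. With `a = f(A)` and
`b = f(2A)` this is by definition the integrand of `J f φ A z`. -/
noncomputable def windowSup (a b z : ℝ) (φ : ℕ → ℂ) (θ : ℝ) : ℝ :=
  ⨆ x : Set.Ioc a b, 1 / z * ‖expSum φ (intervalNat (x : ℝ) (x + z)) θ‖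

theorem norm_expSum_le_card {φ : ℕ → ℂ} (hφ : ∀ n, ‖φ n‖ ≤ 1) (W : Finset ℕ) (θ : ℝ) :
    ‖expSum φ W θ‖ ≤ W.card := by
  refine (norm_sum_le _ _).trans ((Finset.sum_le_sum (g := fun _ => (1 : ℝ)) fun m _ => ?_).trans_eq
    (by simp))
  rw [norm_mul, norm_e, mul_one]; exact hφ m

section windowSup

variable {a b z : ℝ} {φ : ℕ → ℂ}

theorem bddAbove_windowSup (ha : 0 ≤ a) (hz : 0 < z) (hφ : ∀ n, ‖φ n‖ ≤ 1) (θ : ℝ) :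
    BddAbove (Set.range fun x : Set.Ioc a b =>
      1 / z * ‖expSum φ (intervalNat (x : ℝ) (x + z)) θ‖) := by
  refine ⟨1 / z * (z + 1), ?_⟩
  rintro _ ⟨x, rfl⟩
  exact mul_le_mul_of_nonneg_left ((norm_expSum_le_card hφ _ _).trans
    (card_intervalNat_le (ha.trans x.2.1.le) hz.le)) (by positivity)

theorem windowSup_nonneg (hz : 0 < z) (θ : ℝ) : 0 ≤ windowSup a b z φ θ :=
  Real.iSup_nonneg fun _ => by positivity

theorem norm_expSum_le_windowSup (ha : 0 ≤ a) (hz : 0 < z) (hφ : ∀ n, ‖φ n‖ ≤ 1) {x : ℝ}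
    (hx : x ∈ Set.Ioc a b) (θ : ℝ) :
    ‖expSum φ (intervalNat x (x + z)) θ‖ ≤ z * windowSup a b z φ θ := by
  have := le_ciSup (bddAbove_windowSup (b := b) ha hz hφ θ) ⟨x, hx⟩
  calc _ = z * (1 / z * ‖expSum φ (intervalNat x (x + z)) θ‖) := by field_simp
    _ ≤ _ := mul_le_mul_of_nonneg_left this hz.le

theorem windowSup_periodic : Function.Periodic (windowSup a b z φ) 1 := by
  intro θ
  have : ∀ W, expSum φ W (θ + 1) = expSum φ W θ := fun W =>
    Finset.sum_congr rfl fun m _ => by rw [mul_add, mul_one, e_add, e_nat, mul_one]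
  simp only [windowSup, this]

/-- The sums over all windows have a common Lipschitz constant, so their supremum is
continuous. -/
theorem continuous_windowSup (ha : 0 ≤ a) (hz : 0 < z) (hφ : ∀ n, ‖φ n‖ ≤ 1) :
    Continuous (windowSup a b z φ) := by
  set n := ⌊b + z⌋₊
  have hlip : ∀ x ∈ Set.Ioc a b, ∀ θ θ' : ℝ, ‖expSum φ (intervalNat x (x + z)) θ‖ ≤
      ‖expSum φ (intervalNat x (x + z)) θ'‖ +
        (∑ m ∈ Finset.range (n + 1), 2 * Real.pi * m) * |θ - θ'| := by
    intro x hx θ θ'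
    have h1 : ‖expSum φ (intervalNat x (x + z)) θ - expSum φ (intervalNat x (x + z)) θ'‖ ≤
        (∑ m ∈ Finset.range (n + 1), 2 * Real.pi * m) * |θ - θ'| := by
      rw [expSum, expSum, ← Finset.sum_sub_distrib, Finset.sum_mul]
      refine (norm_sum_le _ _).trans ?_
      refine (Finset.sum_le_sum (g := fun m : ℕ => 2 * Real.pi * m * |θ - θ'|) fun m _ => ?_).trans
        (Finset.sum_le_sum_of_subset_of_nonneg ?_ fun _ _ _ => by positivity)
      · rw [← mul_sub, norm_mul]
        refine (mul_le_mul (hφ m) (norm_e_sub_e_le _ _) (norm_nonneg _) zero_le_one).trans_eq ?_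
        rw [← mul_sub, abs_mul, Nat.abs_cast]; ring
      · intro m hm
        have := (Finset.mem_Ioc.1 hm).2
        have : ⌊x + z⌋₊ ≤ n := Nat.floor_mono (by linarith [hx.2])
        rw [Finset.mem_range]; omega
    have := norm_sub_norm_le (expSum φ (intervalNat x (x + z)) θ)
      (expSum φ (intervalNat x (x + z)) θ')
    linarith
  set K := ∑ m ∈ Finset.range (n + 1), 2 * Real.pi * m
  have hK : 0 ≤ K := Finset.sum_nonneg fun _ _ => by positivity
  refine (LipschitzWith.of_le_add_mul (1 / z * K).toNNReal fun θ θ' => ?_).continuous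
  rw [Real.coe_toNNReal _ (by positivity), Real.dist_eq]
  have hnn := windowSup_nonneg (a := a) (b := b) (φ := φ) hz θ'
  refine Real.iSup_le (fun x => ?_) (by positivity)
  refine (mul_le_mul_of_nonneg_left (hlip x x.2 θ θ') (by positivity)).trans ?_
  rw [mul_add, ← mul_assoc]
  exact add_le_add (le_ciSup (bddAbove_windowSup (b := b) ha hz hφ θ') x) le_rfl

theorem integral_e_int (k : ℤ) : ∫ θ in (0 : ℝ)..1, e (k * θ) = if k = 0 then 1 else 0 := by
  split_ifs with hk
  · simp [hk, e]
  · have hc : (2 * Real.pi * Complex.I * k : ℂ) ≠ 0 := by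
      simp [Real.pi_ne_zero, hk]
    have := integral_exp_mul_complex (a := 0) (b := 1) hc
    have h1 : Complex.exp (2 * Real.pi * Complex.I * k) = 1 := by
      rw [Complex.exp_eq_one_iff]; exact ⟨k, by ring⟩
    simp only [Complex.ofReal_one, mul_one, h1, Complex.ofReal_zero, mul_zero, Complex.exp_zero,
      sub_self, zero_div] at this
    rw [← this]
    refine intervalIntegral.integral_congr fun θ _ => ?_
    simp only [e]; push_cast; ring_nf

theorem continuous_e : Continuous e := by
  unfold e; fun_prop

theorem integral_expSum_mul_e {W : Finset ℕ} {m : ℕ} (hm : m ∈ W) :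
    ∫ θ in (0 : ℝ)..1, expSum φ W θ * e (-(m * θ)) = φ m := by
  have : ∀ θ, expSum φ W θ * e (-(m * θ)) = ∑ k ∈ W, φ k * e (((k - m : ℤ) : ℝ) * θ) := by
    intro θ
    rw [expSum, Finset.sum_mul]
    refine Finset.sum_congr rfl fun k _ => ?_
    rw [mul_assoc, ← e_add]; push_cast; ring_nf
  simp_rw [this]
  have hc : ∀ k : ℕ, Continuous fun θ : ℝ => φ k * e (((k - m : ℤ) : ℝ) * θ) := fun k =>
    continuous_const.mul (continuous_e.comp (continuous_const.mul continuous_id))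
  rw [intervalIntegral.integral_finsetSum fun k _ => (hc k).intervalIntegrable _ _]
  simp_rw [intervalIntegral.integral_const_mul, integral_e_int]
  rw [Finset.sum_eq_single m]
  · simp
  · intro k _ hk
    rw [if_neg (by omega), mul_zero]
  · exact fun h => absurd hm h

/-- Every coefficient in the range is recovered from a window that contains it. -/
theorem norm_div_le_integral_windowSup (ha : 0 ≤ a) (hz : 0 < z) (hφ : ∀ n, ‖φ n‖ ≤ 1) {m : ℕ}
    (hm : m ∈ intervalNat a b) (hb : 0 ≤ b) :
    ‖φ m‖ / z ≤ ∫ θ in (0 : ℝ)..1, windowSup a b z φ θ := by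
  rw [mem_intervalNat ha hb] at hm
  obtain ⟨x, hx1, hx2⟩ : ∃ x, max a (m - z) < x ∧ x < m :=
    exists_between (max_lt hm.1 (by linarith))
  have hax : a < x := (le_max_left _ _).trans_lt hx1
  have hmx : m - z < x := (le_max_right _ _).trans_lt hx1
  have hmW : m ∈ intervalNat x (x + z) := by
    rw [mem_intervalNat (by linarith) (by linarith)]; constructor <;> linarith
  rw [div_le_iff₀ hz, mul_comm, ← intervalIntegral.integral_const_mul,
    ← integral_expSum_mul_e (φ := φ) hmW]
  refine intervalIntegral.norm_integral_le_of_norm_le zero_le_one ?_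
    (((continuous_windowSup ha hz hφ).const_mul z).intervalIntegrable _ _)
  refine Filter.Eventually.of_forall fun θ _ => ?_
  rw [norm_mul, norm_e, mul_one]
  exact norm_expSum_le_windowSup ha hz hφ ⟨hax, by linarith [hm.2]⟩ θ

end windowSup

/-! ### The case of constant coefficients -/

theorem four_mul_le_norm_e_sub_one {θ : ℝ} (h0 : 0 ≤ θ) (h1 : θ ≤ 1) :
    4 * min θ (1 - θ) ≤ ‖e θ - 1‖ := by
  have hpi := Real.pi_pos
  rw [e_eq, Complex.norm_exp_I_mul_ofReal_sub_one, show 2 * Real.pi * θ / 2 = Real.pi * θ by ring,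
    Real.norm_eq_abs]
  have hs : 2 * min θ (1 - θ) ≤ Real.sin (Real.pi * θ) := by
    rcases le_total θ (1 / 2) with h | h
    · have := Real.mul_le_sin (x := Real.pi * θ) (by positivity) (by nlinarith)
      rw [show 2 / Real.pi * (Real.pi * θ) = 2 * θ by field_simp] at this
      linarith [min_le_left θ (1 - θ)]
    · have := Real.mul_le_sin (x := Real.pi * (1 - θ)) (by apply mul_nonneg <;> linarith)
        (by nlinarith)
      rw [show 2 / Real.pi * (Real.pi * (1 - θ)) = 2 * (1 - θ) by field_simp,
        show Real.pi * (1 - θ) = Real.pi - Real.pi * θ by ring, Real.sin_pi_sub] at this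
      linarith [min_le_right θ (1 - θ)]
  exact le_trans (by linarith) (le_abs_self _)

theorem norm_expSum_one_mul_le (p q : ℕ) (θ : ℝ) :
    ‖expSum 1 (Finset.Ioc p q) θ‖ * ‖e θ - 1‖ ≤ 2 := by
  rw [← norm_mul]
  rcases le_total q p with h | h
  · rw [Finset.Ioc_eq_empty (by omega)]; simp [expSum]
  have : expSum 1 (Finset.Ioc p q) θ * (e θ - 1) = e (((q + 1 : ℕ) : ℝ) * θ) -
      e (((p + 1 : ℕ) : ℝ) * θ) := by
    have hI : Finset.Ioc p q = Finset.Ico (p + 1) (q + 1) := by ext; simp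
    rw [hI, ← Finset.sum_Ico_sub (fun m : ℕ => e ((m : ℝ) * θ)) (by omega), expSum, Finset.sum_mul]
    refine Finset.sum_congr rfl fun m _ => ?_
    simp only [Pi.one_apply, one_mul, mul_sub, mul_one, ← e_add]
    push_cast; ring_nf
  rw [this]
  refine (norm_sub_le _ _).trans_eq ?_
  rw [norm_e, norm_e]; norm_num

theorem windowSup_one_le {a b z : ℝ} (ha : 0 ≤ a) (hz : 1 ≤ z) {θ : ℝ} (h0 : 0 < θ) (h1 : θ < 1) :
    windowSup a b z 1 θ ≤ 4 * (1 + z * θ)⁻¹ + 4 * (1 + z * (1 - θ))⁻¹ := by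
  have p1 : 0 < 1 + z * θ := by positivity
  have p2 : 0 < 1 + z * (1 - θ) := by have : 0 < 1 - θ := by linarith
                                      positivity
  have hmin : 4 * (1 + z * min θ (1 - θ))⁻¹ ≤ 4 * (1 + z * θ)⁻¹ + 4 * (1 + z * (1 - θ))⁻¹ := by
    rcases min_choice θ (1 - θ) with h | h <;> rw [h]
    · linarith [inv_pos.2 p2]
    · linarith [inv_pos.2 p1]
  refine Real.iSup_le (fun x => ?_) (by positivity)
  refine le_trans ?_ hmin
  have hμ : 0 < min θ (1 - θ) := lt_min h0 (by linarith)
  have hlow := four_mul_le_norm_e_sub_one h0.le h1.le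
  set μ := min θ (1 - θ)
  have b1 := (norm_expSum_le_card (φ := 1) (by simp) (intervalNat (x : ℝ) (x + z)) θ).trans
    (card_intervalNat_le (ha.trans x.2.1.le) (by linarith : 0 ≤ z))
  have b2 : ‖expSum 1 (intervalNat (x : ℝ) (x + z)) θ‖ * ‖e θ - 1‖ ≤ 2 :=
    norm_expSum_one_mul_le _ _ _
  set T := ‖expSum 1 (intervalNat (x : ℝ) (x + z)) θ‖
  have hT : 0 ≤ T := norm_nonneg _
  have b3 : T * (4 * μ) ≤ 2 := (mul_le_mul_of_nonneg_left hlow hT).trans b2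
  rw [← div_eq_mul_inv, le_div_iff₀ (by positivity), one_div, mul_assoc, inv_mul_le_iff₀ (by linarith)]
  nlinarith

theorem integral_windowSup_one_le {a b z : ℝ} (ha : 0 ≤ a) (hz : 1 ≤ z) :
    ∫ θ in (0 : ℝ)..1, windowSup a b z 1 θ ≤ 8 * (Real.log (1 + z) / z) := by
  have hz0 : 0 < z := by linarith
  have c1 : ContinuousOn (fun θ : ℝ => 4 * (1 + z * θ)⁻¹) (Set.uIcc 0 1) := by
    rw [Set.uIcc_of_le zero_le_one]
    refine continuousOn_const.mul (ContinuousOn.inv₀ (by fun_prop) fun θ hθ => ?_)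
    have := mul_nonneg hz0.le hθ.1
    positivity
  have c2 : ContinuousOn (fun θ : ℝ => 4 * (1 + z * (1 - θ))⁻¹) (Set.uIcc 0 1) := by
    rw [Set.uIcc_of_le zero_le_one]
    refine continuousOn_const.mul (ContinuousOn.inv₀ (by fun_prop) fun θ hθ => ?_)
    have := mul_nonneg hz0.le (sub_nonneg.2 hθ.2)
    positivity
  have hi : ∫ θ in (0 : ℝ)..1, 4 * (1 + z * θ)⁻¹ = 4 * (Real.log (1 + z) / z) := by
    rw [intervalIntegral.integral_const_mul,
      intervalIntegral.integral_comp_add_mul (fun x => x⁻¹) hz0.ne' 1, integral_inv_of_pos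
        (by linarith) (by linarith)]
    simp; field_simp
  have hi2 : ∫ θ in (0 : ℝ)..1, 4 * (1 + z * (1 - θ))⁻¹ = 4 * (Real.log (1 + z) / z) := by
    rw [intervalIntegral.integral_comp_sub_left (fun x => 4 * (1 + z * x)⁻¹) 1]
    simpa using hi
  calc ∫ θ in (0 : ℝ)..1, windowSup a b z 1 θ
      ≤ ∫ θ in (0 : ℝ)..1, (4 * (1 + z * θ)⁻¹ + 4 * (1 + z * (1 - θ))⁻¹) := by
        refine intervalIntegral.integral_mono_on_of_le_Ioo zero_le_one
          ((continuous_windowSup ha hz0 (by simp)).intervalIntegrable _ _)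
          (c1.intervalIntegrable.add c2.intervalIntegrable) fun θ hθ => windowSup_one_le ha hz hθ.1 hθ.2
    _ = _ := by
        rw [intervalIntegral.integral_add c1.intervalIntegrable c2.intervalIntegrable, hi, hi2]
        ring

/-! ### Admissible functions -/

/-- The doubling condition with the lower constant weakened to `1/2` and the upper constant `c`
made explicit. -/
structure Doubling (f : ℝ → ℝ) (c : ℝ) : Prop where
  admissible : Admissible f
  one_le : 1 ≤ c
  lower : ∀ x y, 0 < x → x ≤ y → y ≤ 2 * x → deriv (deriv f) x / 2 ≤ deriv (deriv f) y
  upper : ∀ x y, 0 < x → x ≤ y → y ≤ 2 * x → deriv (deriv f) y ≤ c * deriv (deriv f) x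

theorem Admissible.exists_doubling {f : ℝ → ℝ} (hf : Admissible f) : ∃ c, Doubling f c := by
  obtain ⟨c₁, c₂, h1, -, h⟩ := hf.doubling
  refine ⟨c₂, hf, ?_, fun x y hx hxy hy => ?_, fun x y hx hxy hy => (h x y hx hxy hy).2⟩
  · have := (h 1 1 one_pos le_rfl (by norm_num)).2
    have h2 := hf.deriv_deriv_pos 1 one_pos
    by_contra hc
    nlinarith
  · have := (h x y hx hxy hy).1
    have h2 := hf.deriv_deriv_pos x hx
    nlinarith

namespace Admissible

variable {f : ℝ → ℝ} (hf : Admissible f)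
include hf

theorem contDiffAt {x : ℝ} (hx : 0 < x) : ContDiffAt ℝ 2 f x :=
  hf.contDiffOn.contDiffAt (Ioi_mem_nhds hx)

theorem hasStrictDerivAt {x : ℝ} (hx : 0 < x) : HasStrictDerivAt f (deriv f x) x :=
  (hf.contDiffAt hx).hasStrictDerivAt (by norm_num)

theorem contDiffOn_deriv : ContDiffOn ℝ 1 (deriv f) (Set.Ioi 0) :=
  ((contDiffOn_succ_iff_deriv_of_isOpen (n := 1) isOpen_Ioi).1 hf.contDiffOn).2.2

theorem hasDerivAt_deriv {x : ℝ} (hx : 0 < x) :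
    HasDerivAt (deriv f) (deriv (deriv f) x) x :=
  ((hf.contDiffOn_deriv.contDiffAt (Ioi_mem_nhds hx)).differentiableAt (by norm_num)).hasDerivAt

theorem continuousOn_deriv_deriv : ContinuousOn (deriv (deriv f)) (Set.Ioi 0) :=
  hf.contDiffOn_deriv.continuousOn_deriv_of_isOpen isOpen_Ioi le_rfl

theorem exists_sub_eq {x y : ℝ} (hx : 0 < x) (hxy : x ≤ y) :
    ∃ ξ ∈ Set.Icc x y, f y - f x = deriv f ξ * (y - x) := by
  rcases hxy.eq_or_lt with rfl | hlt
  · exact ⟨x, ⟨le_rfl, le_rfl⟩, by ring⟩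
  obtain ⟨ξ, hξ, h⟩ := exists_deriv_eq_slope f hlt
    (fun u hu => (hf.hasStrictDerivAt (hx.trans_le hu.1)).hasDerivAt.continuousAt.continuousWithinAt)
    (fun u hu => (hf.hasStrictDerivAt
      (hx.trans hu.1)).hasDerivAt.differentiableAt.differentiableWithinAt)
  refine ⟨ξ, ⟨hξ.1.le, hξ.2.le⟩, ?_⟩
  rw [h, div_mul_cancel₀ _ (by linarith)]

theorem exists_deriv_sub_eq {x y : ℝ} (hx : 0 < x) (hxy : x ≤ y) :
    ∃ ξ ∈ Set.Icc x y, deriv f y - deriv f x = deriv (deriv f) ξ * (y - x) := by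
  rcases hxy.eq_or_lt with rfl | hlt
  · exact ⟨x, ⟨le_rfl, le_rfl⟩, by ring⟩
  obtain ⟨ξ, hξ, h⟩ := exists_deriv_eq_slope (deriv f) hlt
    (fun u hu => (hf.hasDerivAt_deriv (hx.trans_le hu.1)).continuousAt.continuousWithinAt)
    (fun u hu => (hf.hasDerivAt_deriv
      (hx.trans hu.1)).differentiableAt.differentiableWithinAt)
  refine ⟨ξ, ⟨hξ.1.le, hξ.2.le⟩, ?_⟩
  rw [h, div_mul_cancel₀ _ (by linarith)]

theorem deriv_mono {x y : ℝ} (hx : 0 < x) (hxy : x ≤ y) : deriv f x ≤ deriv f y := by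
  obtain ⟨ξ, hξ, h⟩ := hf.exists_deriv_sub_eq hx hxy
  have := mul_nonneg (hf.deriv_deriv_pos ξ (hx.trans_le hξ.1)).le (sub_nonneg.2 hxy)
  linarith

/-- Convexity: `f` grows at least linearly with its initial slope. -/
theorem deriv_mul_le_sub {x y : ℝ} (hx : 0 < x) (hxy : x ≤ y) :
    deriv f x * (y - x) ≤ f y - f x := by
  obtain ⟨ξ, hξ, h⟩ := hf.exists_sub_eq hx hxy
  rw [h]
  exact mul_le_mul_of_nonneg_right (hf.deriv_mono hx hξ.1) (sub_nonneg.2 hxy)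

theorem sub_le_deriv_mul {x y : ℝ} (hx : 0 < x) (hxy : x ≤ y) :
    f y - f x ≤ deriv f y * (y - x) := by
  obtain ⟨ξ, hξ, h⟩ := hf.exists_sub_eq hx hxy
  rw [h]
  exact mul_le_mul_of_nonneg_right (hf.deriv_mono (hx.trans_le hξ.1) hξ.2) (sub_nonneg.2 hxy)

theorem strictMonoOn : StrictMonoOn f (Set.Ioi 0) := by
  intro x hx y _ hxy
  have := hf.deriv_mul_le_sub hx hxy.le
  have := mul_pos (hf.deriv_pos x hx) (sub_pos.2 hxy)
  linarith

theorem le_iff {x y : ℝ} (hx : 0 < x) (hy : 0 < y) : f x ≤ f y ↔ x ≤ y :=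
  hf.strictMonoOn.le_iff_le hx hy

theorem lt_iff {x y : ℝ} (hx : 0 < x) (hy : 0 < y) : f x < f y ↔ x < y :=
  hf.strictMonoOn.lt_iff_lt hx hy

/-! ### The inverse function -/

theorem inv_apply {x : ℝ} (hx : 0 < x) : inv f (f x) = x :=
  PiatetskiShapiro.inv_apply hf.strictMonoOn.injOn hx

theorem hasDerivAt_inv {x : ℝ} (hx : 0 < x) : HasDerivAt (inv f) (deriv f x)⁻¹ (f x) := by
  refine ((hf.hasStrictDerivAt hx).to_local_left_inverse (hf.deriv_pos x hx).ne' ?_).hasDerivAt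
  filter_upwards [Ioi_mem_nhds hx] with u hu using hf.inv_apply hu

theorem exists_eq_of_mem {x y w : ℝ} (hx : 0 < x) (hxy : x ≤ y) (h1 : f x ≤ w) (h2 : w ≤ f y) :
    ∃ t, x ≤ t ∧ t ≤ y ∧ f t = w := by
  have hc : ContinuousOn f (Set.Icc x y) := fun u hu =>
    (hf.hasStrictDerivAt (hx.trans_le hu.1)).hasDerivAt.continuousAt.continuousWithinAt
  obtain ⟨t, ht, h⟩ := intermediate_value_Icc hxy hc ⟨h1, h2⟩
  exact ⟨t, ht.1, ht.2, h⟩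

theorem exists_eq_of_mem_uIcc {x y w : ℝ} (hx : 0 < x) (hxy : x ≤ y)
    (hw : w ∈ Set.uIcc (f x) (f y)) : ∃ t, x ≤ t ∧ t ≤ y ∧ f t = w := by
  rw [Set.uIcc_of_le ((hf.le_iff hx (hx.trans_le hxy)).2 hxy)] at hw
  exact hf.exists_eq_of_mem hx hxy hw.1 hw.2

theorem mapsTo_inv {x y : ℝ} (hx : 0 < x) (hxy : x ≤ y) :
    Set.MapsTo (inv f) (Set.uIcc (f x) (f y)) (Set.Ioi 0) := by
  intro w hw
  obtain ⟨t, h1, -, rfl⟩ := hf.exists_eq_of_mem_uIcc hx hxy hw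
  rw [hf.inv_apply (hx.trans_le h1)]
  exact hx.trans_le h1

theorem continuousOn_inv {x y : ℝ} (hx : 0 < x) (hxy : x ≤ y) :
    ContinuousOn (inv f) (Set.uIcc (f x) (f y)) := by
  intro w hw
  obtain ⟨t, h1, -, rfl⟩ := hf.exists_eq_of_mem_uIcc hx hxy hw
  exact (hf.hasDerivAt_inv (hx.trans_le h1)).continuousAt.continuousWithinAt

theorem continuousOn_slope {x y : ℝ} (hx : 0 < x) (hxy : x ≤ y) :
    ContinuousOn (fun w => (deriv f (inv f w))⁻¹) (Set.uIcc (f x) (f y)) :=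
  (hf.contDiffOn_deriv.continuousOn.comp (hf.continuousOn_inv hx hxy)
    (hf.mapsTo_inv hx hxy)).inv₀ fun _ hw => (hf.deriv_pos _ (hf.mapsTo_inv hx hxy hw)).ne'

end Admissible

/-! ### Consequences of the doubling condition -/

namespace Doubling

variable {f : ℝ → ℝ} {c : ℝ} (hf : Doubling f c)
include hf

theorem mul_deriv_deriv_le {x : ℝ} (hx : 0 < x) :
    x * deriv (deriv f) x ≤ 2 * c * deriv f x := by
  have hx2 : 0 < x / 2 := by positivity
  obtain ⟨ξ, hξ, h⟩ := hf.admissible.exists_deriv_sub_eq hx2 (by linarith : x / 2 ≤ x)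
  have h1 := hf.upper ξ x (hx2.trans_le hξ.1) hξ.2 (by linarith [hξ.1])
  have h2 := hf.admissible.deriv_pos _ hx2
  have hc := hf.one_le
  nlinarith

theorem deriv_sub_le {A t s : ℝ} (hA : 0 < A) (h1 : A ≤ t) (h2 : t ≤ s) (h3 : s ≤ 2 * A) :
    deriv f s - deriv f t ≤ c * deriv (deriv f) A * (s - t) := by
  obtain ⟨ξ, hξ, h⟩ := hf.admissible.exists_deriv_sub_eq (hA.trans_le h1) h2
  rw [h]
  exact mul_le_mul_of_nonneg_right (hf.upper A ξ hA (h1.trans hξ.1) (hξ.2.trans h3))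
    (sub_nonneg.2 h2)

theorem deriv_two_mul_le {x : ℝ} (hx : 0 < x) :
    deriv f (2 * x) ≤ (1 + 2 * c ^ 2) * deriv f x := by
  have h1 := hf.deriv_sub_le hx le_rfl (by linarith : x ≤ 2 * x) le_rfl
  have h2 := hf.mul_deriv_deriv_le hx
  have hc := hf.one_le
  nlinarith

/-- As `x f''(x)` does not decrease under doubling, each of the `O(log A)` dyadic pieces below `A`
contributes `O(A f''(A))` to `f'(A)`. -/
theorem exists_deriv_le_log_mul : ∃ K, 0 < K ∧ ∀ A : ℝ, 2 ≤ A →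
    deriv f A ≤ K * (A * deriv (deriv f) A * Real.log A) := by
  have hc := hf.one_le
  have hl : 0 < Real.log 2 := Real.log_pos (by norm_num)
  have p1 := hf.admissible.deriv_deriv_pos 1 one_pos
  have p2 := hf.admissible.deriv_pos 2 two_pos
  have key : ∀ (n : ℕ) (x : ℝ), 1 ≤ x → x ≤ 2 →
      deriv (deriv f) 1 / 2 ≤ 2 ^ n * x * deriv (deriv f) (2 ^ n * x) ∧
      deriv f (2 ^ n * x) ≤ deriv f 2 + c * n * (2 ^ n * x * deriv (deriv f) (2 ^ n * x)) := by
    intro n x hx1 hx2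
    induction n with
    | zero =>
      have h1 := hf.lower 1 x one_pos hx1 (by linarith)
      have h2 := hf.admissible.deriv_mono (by linarith) hx2
      constructor
      · simp only [pow_zero, one_mul]; nlinarith
      · simpa using h2
    | succ n ih =>
      obtain ⟨i1, i2⟩ := ih
      have hu : 0 < 2 ^ n * x := by positivity
      have hstep : 2 ^ (n + 1) * x = 2 * (2 ^ n * x) := by ring
      rw [hstep]
      set u := 2 ^ n * x
      have l := hf.lower u (2 * u) hu (by linarith) le_rfl
      have d := hf.deriv_sub_le hu le_rfl (by linarith : u ≤ 2 * u) le_rfl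
      have hmono : u * deriv (deriv f) u ≤ 2 * u * deriv (deriv f) (2 * u) := by nlinarith
      refine ⟨i1.trans hmono, ?_⟩
      push_cast
      have : c * (n + 1) * (u * deriv (deriv f) u) ≤
          c * (n + 1) * (2 * u * deriv (deriv f) (2 * u)) := by gcongr
      nlinarith
  refine ⟨(2 * deriv f 2 / deriv (deriv f) 1 + c) / Real.log 2, by positivity, fun A hA => ?_⟩
  obtain ⟨n, hn1, hn2⟩ := exists_nat_pow_near (by linarith : 1 ≤ A) (by norm_num : (1 : ℝ) < 2)
  have hpow : (0 : ℝ) < 2 ^ n := by positivity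
  obtain ⟨k1, k2⟩ := key n (A / 2 ^ n) ((one_le_div hpow).2 hn1)
    ((div_le_iff₀ hpow).2 (by rw [pow_succ] at hn2; linarith))
  rw [mul_div_cancel₀ _ hpow.ne'] at k1 k2
  set D := A * deriv (deriv f) A
  have hnl : n * Real.log 2 ≤ Real.log A := by
    rw [← Real.log_pow]; exact Real.log_le_log hpow hn1
  have hAl : Real.log 2 ≤ Real.log A := Real.log_le_log (by norm_num) hA
  have hD : 0 < D := by linarith
  calc deriv f A ≤ deriv f 2 + c * n * D := k2
    _ ≤ 2 * deriv f 2 / deriv (deriv f) 1 * D + c * n * D := by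
        gcongr
        rw [div_mul_eq_mul_div, le_div_iff₀ p1]; nlinarith
    _ = (2 * deriv f 2 / deriv (deriv f) 1 * (D * Real.log 2) + c * (D * (n * Real.log 2)))
        / Real.log 2 := by field_simp
    _ ≤ (2 * deriv f 2 / deriv (deriv f) 1 * (D * Real.log A) + c * (D * Real.log A))
        / Real.log 2 := by gcongr
    _ = _ := by ring

/-- The tangent to `f` at `t` yields a linear approximation to the inverse function. -/
theorem linearization {A t s W : ℝ} (hA : 0 < A) (h1 : A ≤ t) (h2 : t ≤ s) (h3 : s ≤ 2 * A)
    (hW : f s - f t ≤ W) :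
    s ≤ t + (f s - f t) / deriv f t ∧
    t + (f s - f t) / deriv f t ≤ s + c * deriv (deriv f) A * W ^ 2 / deriv f A ^ 3 ∧
    |(deriv f t)⁻¹ - (deriv f s)⁻¹| ≤ c * deriv (deriv f) A * W / deriv f A ^ 3 := by
  have ht : 0 < t := hA.trans_le h1
  have hadm := hf.admissible
  have hP := hadm.deriv_pos A hA
  have hQ := hadm.deriv_deriv_pos A hA
  have hPt := hadm.deriv_mono hA h1
  have hPs := hadm.deriv_mono hA (h1.trans h2)
  have hts := hadm.deriv_mono ht h2
  have hd := hf.deriv_sub_le hA h1 h2 h3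
  have hlow := hadm.deriv_mul_le_sub ht h2
  have hup := hadm.sub_le_deriv_mul ht h2
  have hc := hf.one_le
  have hst : s - t ≤ W / deriv f A := by
    rw [le_div_iff₀ hP]
    nlinarith [sub_nonneg.2 h2]
  have hst0 := sub_nonneg.2 h2
  set P := deriv f A
  set Q := deriv (deriv f) A
  set Dt := deriv f t
  set Ds := deriv f s
  have hDt : 0 < Dt := hP.trans_le hPt
  have hDs : 0 < Ds := hP.trans_le hPs
  have hW0 : 0 ≤ W / P := hst0.trans hst
  have hdW : Ds - Dt ≤ c * Q * (W / P) := hd.trans (by gcongr)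
  refine ⟨?_, ?_, ?_⟩
  · rw [← sub_le_iff_le_add', le_div_iff₀ hDt]; linarith
  · have : t + (f s - f t) / Dt - s ≤ (Ds - Dt) * (s - t) / P := by
      calc t + (f s - f t) / Dt - s = (f s - f t - Dt * (s - t)) / Dt := by field_simp; ring
        _ ≤ ((Ds - Dt) * (s - t)) / Dt := by gcongr; linarith
        _ ≤ _ := by
          apply div_le_div_of_nonneg_left _ hP hPt
          exact mul_nonneg (by linarith) hst0
    have h4 : (Ds - Dt) * (s - t) / P ≤ (c * Q * (W / P)) * (W / P) / P := by gcongr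
    have h5 : (c * Q * (W / P)) * (W / P) / P = c * Q * W ^ 2 / P ^ 3 := by field_simp
    linarith
  · have : Dt⁻¹ - Ds⁻¹ = (Ds - Dt) / (Dt * Ds) := by field_simp
    rw [this, abs_of_nonneg (div_nonneg (by linarith) (by positivity))]
    calc (Ds - Dt) / (Dt * Ds) ≤ (c * Q * (W / P)) / (P * P) := by gcongr
      _ = _ := by field_simp

end Doubling

/-! ### Averaging over windows -/

theorem mem_window_iff {a b z x : ℝ} (ha : 0 ≤ a) (hz : 0 ≤ z) (hx : x ∈ Set.Ioc a (b - z - 1))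
    (m : ℕ) : m ∈ intervalNat x (x + z) ↔ m ∈ intervalNat a b ∧ x ∈ Set.Ico ((m : ℝ) - z) m := by
  have h1 := hx.1
  have h2 := hx.2
  rw [mem_intervalNat (by linarith) (by linarith), mem_intervalNat ha (by linarith), Set.mem_Ico]
  constructor
  · rintro ⟨h3, h4⟩; exact ⟨⟨by linarith, by linarith⟩, by linarith, h3⟩
  · rintro ⟨-, h3, h4⟩; exact ⟨h4, by linarith⟩

/-- A sum over `(a, b]` is the average of its window sums, up to the terms within `z + 1` of the
end points, which belong to fewer windows. -/
theorem mul_norm_sum_le_integral_window {a b z M : ℝ} {F : ℕ → ℂ} (ha : 0 ≤ a) (hz : 1 ≤ z)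
    (hab : a ≤ b - z - 1) (hF : ∀ m ∈ intervalNat a b, ‖F m‖ ≤ M) (hM : 0 ≤ M) :
    z * ‖∑ m ∈ intervalNat a b, F m‖ ≤
      ‖∫ x in a..(b - z - 1), ∑ m ∈ intervalNat x (x + z), F m‖ + z * (M * (5 * z)) := by
  set b' := b - z - 1 with hb'
  set v : ℕ → ℝ := fun m =>
    MeasureTheory.volume.real (Set.Ico ((m : ℝ) - z) m ∩ Set.Ioc a b') with hv
  have hz0 : 0 ≤ z := by linarith
  have hint : ∫ x in a..b', ∑ m ∈ intervalNat x (x + z), F m =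
      ∑ m ∈ intervalNat a b, (v m : ℂ) * F m := by
    rw [intervalIntegral.integral_of_le hab]
    have : ∀ x ∈ Set.Ioc a b', ∑ m ∈ intervalNat x (x + z), F m =
        ∑ m ∈ intervalNat a b, (Set.Ico ((m : ℝ) - z) m).indicator (fun _ => F m) x := by
      intro x hx
      classical
      have hW : intervalNat x (x + z) =
          (intervalNat a b).filter fun m : ℕ => x ∈ Set.Ico ((m : ℝ) - z) m := by
        ext m; rw [Finset.mem_filter, mem_window_iff ha hz0 hx]
      rw [hW, Finset.sum_filter]
      exact Finset.sum_congr rfl fun m _ => by rw [Set.indicator_apply]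
    rw [MeasureTheory.setIntegral_congr_fun measurableSet_Ioc this,
      MeasureTheory.integral_finsetSum]
    · refine Finset.sum_congr rfl fun m _ => ?_
      rw [MeasureTheory.integral_indicator_const _ measurableSet_Ico,
        MeasureTheory.measureReal_restrict_apply measurableSet_Ico, Complex.real_smul]
    · intro m _
      exact (MeasureTheory.integrable_const _).indicator measurableSet_Ico
  have hv0 : ∀ m, 0 ≤ v m := fun m => MeasureTheory.measureReal_nonneg
  have hvz : ∀ m, v m ≤ z := fun m => by
    refine (MeasureTheory.measureReal_mono Set.inter_subset_left (by simp)).trans_eq ?_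
    rw [Real.volume_real_Ico_of_le (by linarith)]; ring
  have hveq : ∀ m : ℕ, a + z < m → (m : ℝ) ≤ b' → v m = z := fun m h1 h2 => by
    have : Set.Ico ((m : ℝ) - z) m ∩ Set.Ioc a b' = Set.Ico ((m : ℝ) - z) m := by
      rw [Set.inter_eq_left]
      exact fun x hx => ⟨by linarith [hx.1], by linarith [hx.2]⟩
    rw [hv]; simp only
    rw [this, Real.volume_real_Ico_of_le (by linarith)]; ring
  have hsplit : (z : ℂ) * ∑ m ∈ intervalNat a b, F m =
      ∑ m ∈ intervalNat a b, (v m : ℂ) * F m +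
      ∑ m ∈ intervalNat a b, ((z - v m : ℝ) : ℂ) * F m := by
    rw [Finset.mul_sum, ← Finset.sum_add_distrib]
    exact Finset.sum_congr rfl fun m _ => by push_cast; ring
  have hbad : ‖∑ m ∈ intervalNat a b, ((z - v m : ℝ) : ℂ) * F m‖ ≤ z * (M * (5 * z)) := by
    classical
    set T := intervalNat a (a + z) ∪ intervalNat b' (b' + (z + 1)) with hT
    have hTcard : (T.card : ℝ) ≤ 5 * z := by
      have h1 := card_intervalNat_le ha hz0
      have h2 := card_intervalNat_le (ha.trans hab) (by linarith : 0 ≤ z + 1)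
      have h3 : (T.card : ℝ) ≤ (intervalNat a (a + z)).card + (intervalNat b' (b' + (z + 1))).card :=
        by exact_mod_cast Finset.card_union_le _ _
      linarith
    have hb0 : b' + (z + 1) = b := by rw [hb']; ring
    calc ‖∑ m ∈ intervalNat a b, ((z - v m : ℝ) : ℂ) * F m‖
        ≤ ∑ m ∈ intervalNat a b, (if m ∈ T then z * M else 0) := by
          refine (norm_sum_le _ _).trans (Finset.sum_le_sum fun m hm => ?_)
          rw [norm_mul, Complex.norm_real, Real.norm_eq_abs, abs_of_nonneg (by linarith [hvz m])]
          split_ifs with h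
          · exact mul_le_mul (by linarith [hv0 m]) (hF m hm) (norm_nonneg _) hz0
          · rw [mem_intervalNat ha (by linarith)] at hm
            rw [hT, Finset.mem_union, hb0, mem_intervalNat ha (by linarith),
              mem_intervalNat (ha.trans hab) (by linarith)] at h
            push Not at h
            have h1 := h.1 hm.1
            have h2 : (m : ℝ) ≤ b' := by
              by_contra hc
              exact absurd (h.2 (not_le.1 hc)) (not_lt.2 hm.2)
            rw [hveq m h1 h2]; simp
      _ = ((intervalNat a b).filter (· ∈ T)).card * (z * M) := by
          rw [← Finset.sum_filter, Finset.sum_const, nsmul_eq_mul]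
      _ ≤ (5 * z) * (z * M) := by
          refine mul_le_mul_of_nonneg_right (le_trans ?_ hTcard) (by positivity)
          exact_mod_cast Finset.card_le_card fun m hm => (Finset.mem_filter.1 hm).2
      _ = z * (M * (5 * z)) := by ring
  have hn : z * ‖∑ m ∈ intervalNat a b, F m‖ = ‖(z : ℂ) * ∑ m ∈ intervalNat a b, F m‖ := by
    rw [norm_mul, Complex.norm_real, Real.norm_eq_abs, abs_of_nonneg hz0]
  rw [hn, hsplit, hint]
  exact (norm_add_le _ _).trans (add_le_add le_rfl hbad)

/-! ### Averaging over the slopes -/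

theorem integral_periodic_le {R : ℝ → ℝ} (hc : Continuous R) (hp : Function.Periodic R 1)
    (h0 : ∀ θ, 0 ≤ R θ) (p q : ℝ) :
    ∫ θ in p..q, R θ ≤ (q - p + 1) * ∫ θ in (0 : ℝ)..1, R θ := by
  have hi : ∀ u v, IntervalIntegrable R MeasureTheory.volume u v := fun u v =>
    hc.intervalIntegrable u v
  have hI : 0 ≤ ∫ θ in (0 : ℝ)..1, R θ :=
    intervalIntegral.integral_nonneg zero_le_one fun θ _ => h0 θ
  have h1 := hp.intervalIntegral_add_zsmul_eq ⌈q - p⌉ p hi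
  rw [hp.intervalIntegral_add_eq p 0, zero_add, zsmul_eq_mul, zsmul_eq_mul, mul_one] at h1
  have hceil := Int.le_ceil (q - p)
  have hceil2 := (Int.ceil_lt_add_one (q - p)).le
  calc ∫ θ in p..q, R θ ≤ ∫ θ in p..(p + ⌈q - p⌉), R θ := by
        rw [← intervalIntegral.integral_add_adjacent_intervals (hi p q) (hi q (p + ⌈q - p⌉))]
        have := intervalIntegral.integral_nonneg (f := R) (μ := MeasureTheory.volume)
          (by linarith : q ≤ p + ⌈q - p⌉) fun θ _ => h0 θ
        linarith
    _ = ⌈q - p⌉ * ∫ θ in (0 : ℝ)..1, R θ := h1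
    _ ≤ _ := mul_le_mul_of_nonneg_right hceil2 hI

/-- As `x` runs over `[f(A), f(b)]`, the frequency `h / f'(f⁻¹(x))` moves monotonically with speed at
least of order `h f''(A) / f'(A)³`; this is the substitution that turns the average over the windows
into an average over the frequency. -/
theorem Doubling.integral_comp_slope_le {f : ℝ → ℝ} {c : ℝ} (hf : Doubling f c) {R : ℝ → ℝ}
    (hc : Continuous R) (hp : Function.Periodic R 1) (h0 : ∀ θ, 0 ≤ R θ) {A b h : ℝ} (hA : 0 < A)
    (hAb : A ≤ b) (hb : b ≤ 2 * A) (hh : 0 < h) :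
    ∫ x in (f A)..(f b), R (h * (deriv f (inv f x))⁻¹) ≤
      2 * (1 + 2 * c ^ 2) ^ 3 * deriv f A ^ 3 / (h * deriv (deriv f) A) *
        (h * (c * (A * deriv (deriv f) A)) / deriv f A ^ 2 + 1) * ∫ θ in (0 : ℝ)..1, R θ := by
  have hadm := hf.admissible
  have hP := hadm.deriv_pos A hA
  have hQ := hadm.deriv_deriv_pos A hA
  have hB := hf.deriv_two_mul_le hA
  have hone := hf.one_le
  set P := deriv f A
  set Q := deriv (deriv f) A
  set B := 1 + 2 * c ^ 2
  set u : ℝ → ℝ := fun x => h * (deriv f (inv f x))⁻¹ with hu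
  set u' : ℝ → ℝ := fun x => h * (-(deriv (deriv f) (inv f x) * (deriv f (inv f x))⁻¹) /
    deriv f (inv f x) ^ 2) with hu'
  have hfab : f A ≤ f b := (hadm.le_iff hA (hA.trans_le hAb)).2 hAb
  have hpt := fun x => hadm.exists_eq_of_mem_uIcc (w := x) hA hAb
  have hder : ∀ x ∈ Set.uIcc (f A) (f b), HasDerivAt u (u' x) x := by
    intro x hx
    obtain ⟨t, h1, -, rfl⟩ := hpt x hx
    have ht : 0 < t := hA.trans_le h1
    have hg := hadm.hasDerivAt_inv ht
    have hd : HasDerivAt (deriv f) (deriv (deriv f) (inv f (f t))) (inv f (f t)) := by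
      rw [hadm.inv_apply ht]; exact hadm.hasDerivAt_deriv ht
    have hcomp := HasDerivAt.comp (f t) hd hg
    have hne : (deriv f ∘ inv f) (f t) ≠ 0 := by
      simp only [Function.comp_apply, hadm.inv_apply ht]; exact (hadm.deriv_pos t ht).ne'
    have := (hcomp.inv hne).const_mul h
    have hval : h * (-(deriv (deriv f) (inv f (f t)) * (deriv f t)⁻¹) /
        (deriv f ∘ inv f) (f t) ^ 2) = u' (f t) := by
      simp only [hu', Function.comp_apply, hadm.inv_apply ht]
    rw [hval] at this
    exact this
  have hmaps := hadm.mapsTo_inv hA hAb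
  have hgc := hadm.continuousOn_inv hA hAb
  have hu'c : ContinuousOn u' (Set.uIcc (f A) (f b)) := by
    refine continuousOn_const.mul (ContinuousOn.div (ContinuousOn.neg
      (ContinuousOn.mul (hadm.continuousOn_deriv_deriv.comp hgc hmaps)
        (hadm.continuousOn_slope hA hAb)))
      ((hadm.contDiffOn_deriv.continuousOn.comp hgc hmaps).pow 2)
      fun x hx => pow_ne_zero 2 (hadm.deriv_pos _ (hmaps hx)).ne')
  have hsub := intervalIntegral.integral_comp_mul_deriv' hder hu'c hc.continuousOn
  have huc : ContinuousOn u (Set.uIcc (f A) (f b)) := fun x hx =>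
    (hder x hx).continuousAt.continuousWithinAt
  set K := 2 * B ^ 3 * P ^ 3 / (h * Q) with hK
  have hK0 : 0 ≤ K := by positivity
  have hRu : ContinuousOn (R ∘ u) (Set.uIcc (f A) (f b)) := hc.comp_continuousOn huc
  have hstep : ∫ x in (f A)..(f b), R (u x) ≤ ∫ x in (f A)..(f b), K * (-((R ∘ u) x * u' x)) := by
    refine intervalIntegral.integral_mono_on hfab hRu.intervalIntegrable
      (continuousOn_const.mul (hRu.mul hu'c).neg).intervalIntegrable fun x hx => ?_
    rw [← Set.uIcc_of_le hfab] at hx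
    obtain ⟨t, h1, h2, rfl⟩ := hpt x hx
    have ht : 0 < t := hA.trans_le h1
    have hDt := hadm.deriv_pos t ht
    have hDtP : deriv f t ≤ B * P := (hadm.deriv_mono ht (h2.trans hb)).trans hB
    have hQt : Q / 2 ≤ deriv (deriv f) t := hf.lower A t hA h1 (h2.trans hb)
    have hspeed : 1 ≤ K * -u' (f t) := by
      rw [hu']
      simp only
      rw [hadm.inv_apply ht]
      have : K * -(h * (-(deriv (deriv f) t * (deriv f t)⁻¹) / deriv f t ^ 2)) =
          (2 * deriv (deriv f) t / Q) * ((B * P) ^ 3 / deriv f t ^ 3) := by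
        rw [hK]; field_simp
      rw [this]
      have e1 : 1 ≤ 2 * deriv (deriv f) t / Q := by rw [le_div_iff₀ hQ]; linarith
      have e2 : 1 ≤ (B * P) ^ 3 / deriv f t ^ 3 := by
        rw [le_div_iff₀ (by positivity), one_mul]; gcongr
      exact one_le_mul_of_one_le_of_one_le e1 e2
    calc R (u (f t)) = R (u (f t)) * 1 := (mul_one _).symm
      _ ≤ R (u (f t)) * (K * -u' (f t)) := mul_le_mul_of_nonneg_left hspeed (h0 _)
      _ = _ := by simp only [Function.comp_apply]; ring
  rw [intervalIntegral.integral_const_mul, intervalIntegral.integral_neg, hsub,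
    ← intervalIntegral.integral_symm] at hstep
  refine hstep.trans ?_
  rw [mul_assoc]
  refine mul_le_mul_of_nonneg_left ?_ hK0
  have hDb := hadm.deriv_mono hA hAb
  have hub : u (f b) = h * (deriv f b)⁻¹ := by
    simp only [hu]; rw [hadm.inv_apply (hA.trans_le hAb)]
  have huA : u (f A) = h * P⁻¹ := by simp only [hu]; rw [hadm.inv_apply hA]
  have hdist : u (f A) - u (f b) ≤ h * (c * (A * Q)) / P ^ 2 := by
    rw [hub, huA]
    have hd := hf.deriv_sub_le hA le_rfl hAb hb
    have hDb0 : 0 < deriv f b := hP.trans_le hDb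
    have : h * P⁻¹ - h * (deriv f b)⁻¹ = h * (deriv f b - P) / (P * deriv f b) := by
      field_simp
    rw [this]
    have e1 : deriv f b - P ≤ c * (A * Q) := hd.trans (by
      have : c * Q * (b - A) ≤ c * Q * A := by gcongr; linarith
      linarith)
    calc h * (deriv f b - P) / (P * deriv f b) ≤ h * (c * (A * Q)) / (P * P) := by gcongr
      _ = _ := by ring
  refine (integral_periodic_le hc hp h0 _ _).trans (mul_le_mul_of_nonneg_right (by linarith) ?_)
  exact intervalIntegral.integral_nonneg zero_le_one fun θ _ => h0 θ

/-! ### Counting the integers `n` with `⌊f(n)⌋ = m` -/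

/-- The number of `n` in `(A, 2A]` with `⌊f(n)⌋ = m`. -/
noncomputable def hits (f : ℝ → ℝ) (A m : ℕ) : ℕ :=
  ((Finset.Ioc A (2 * A)).filter fun n : ℕ => ⌊f n⌋₊ = m).card

theorem Admissible.add_one_le {f : ℝ → ℝ} (hf : Admissible f) {A x y : ℝ} (hA : 0 < A)
    (hP : 1 ≤ deriv f A) (hx : A ≤ x) (hxy : x + 1 ≤ y) : f x + 1 ≤ f y := by
  have h1 := hf.deriv_mul_le_sub (hA.trans_le hx) (by linarith : x ≤ y)
  have h2 := hP.trans (hf.deriv_mono hA hx)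
  nlinarith

theorem Admissible.hits_le_one {f : ℝ → ℝ} (hf : Admissible f) {A : ℕ} (hA : 0 < A)
    (hP : 1 ≤ deriv f A) (m : ℕ) : hits f A m ≤ 1 := by
  have hA' : (0 : ℝ) < A := by exact_mod_cast hA
  have key : ∀ n n' : ℕ, A < n → n < n' → ⌊f n⌋₊ = m → ⌊f n'⌋₊ = m → False := by
    intro n n' h1 h2 h3 h4
    have hn : (A : ℝ) ≤ n := by exact_mod_cast h1.le
    have hn' : (n : ℝ) + 1 ≤ n' := by exact_mod_cast h2
    have h5 := hf.add_one_le hA' hP hn hn'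
    have h6 := Nat.floor_le (hf.pos n (by linarith)).le
    have h7 := Nat.lt_floor_add_one (f n')
    rw [h3] at h6
    rw [h4] at h7
    linarith
  refine Finset.card_le_one.2 fun n hn n' hn' => ?_
  rw [Finset.mem_filter, Finset.mem_Ioc] at hn hn'
  rcases lt_trichotomy n n' with h | h | h
  · exact (key n n' hn.1.1 h hn.2 hn'.2).elim
  · exact h
  · exact (key n' n hn'.1.1 h hn'.2 hn.2).elim

/-- As `f' ≥ 1` on the range, `f(A + 1) ≥ f(A) + 1`, so that no `⌊f(n)⌋` with `n > A` is at or below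
`f(A)`. -/
theorem Admissible.sum_floor_eq {f : ℝ → ℝ} (hf : Admissible f) {A : ℕ} (hA : 0 < A)
    (hP : 1 ≤ deriv f A) (φ : ℕ → ℂ) :
    ∑ n ∈ Finset.Ioc A (2 * A), φ ⌊f n⌋₊ =
      ∑ m ∈ intervalNat (f A) (f (2 * A)), φ m * hits f A m := by
  have hA' : (0 : ℝ) < A := by exact_mod_cast hA
  rw [← Finset.sum_fiberwise_of_maps_to (g := fun n : ℕ => ⌊f n⌋₊)
    (t := intervalNat (f A) (f (2 * A)))]
  · refine Finset.sum_congr rfl fun m _ => ?_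
    rw [Finset.sum_congr rfl (g := fun _ => φ m) fun n hn => by rw [(Finset.mem_filter.1 hn).2],
      Finset.sum_const, nsmul_eq_mul, hits, mul_comm]
  · intro n hn
    rw [Finset.mem_Ioc] at hn
    have h1 : (A : ℝ) + 1 ≤ n := by exact_mod_cast hn.1
    have h2 : (n : ℝ) ≤ 2 * A := by exact_mod_cast hn.2
    rw [mem_intervalNat (hf.pos _ hA').le (hf.pos _ (by linarith)).le]
    have h3 := hf.add_one_le hA' hP le_rfl h1
    have h4 := Nat.lt_floor_add_one (f n)
    have h5 := Nat.floor_le (hf.pos n (by linarith)).le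
    have h6 := (hf.le_iff (by linarith : (0 : ℝ) < n) (by linarith)).2 h2
    constructor <;> linarith

/-- The `n` counted by `hits` are the integers in `[s, s')`, where `s` and `s'` are the preimages of
`m` and `m + 1`. -/
theorem Admissible.hits_eq {f : ℝ → ℝ} (hf : Admissible f) {A : ℕ} (hA : 0 < A) {m : ℕ}
    {s s' : ℝ} (hs : A < s) (hs' : s' ≤ 2 * A) (hss : s < s') (h1 : f s = m) (h2 : f s' = m + 1) :
    (hits f A m : ℝ) = (⌈s'⌉ : ℝ) - ⌈s⌉ := by
  have hA' : (0 : ℝ) < A := by exact_mod_cast hA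
  have hs0 : 0 < s := hA'.trans hs
  have hfil : (Finset.Ioc A (2 * A)).filter (fun n : ℕ => ⌊f n⌋₊ = m) = Finset.Ico ⌈s⌉₊ ⌈s'⌉₊ := by
    ext n
    rw [Finset.mem_filter, Finset.mem_Ioc, Finset.mem_Ico, Nat.ceil_le, Nat.lt_ceil]
    constructor
    · rintro ⟨⟨h3, h4⟩, h5⟩
      have hn : (0 : ℝ) < n := hA'.trans (by exact_mod_cast h3)
      rw [Nat.floor_eq_iff (hf.pos n hn).le] at h5
      rw [← hf.le_iff hs0 hn, ← hf.lt_iff hn (hs0.trans hss), h1, h2]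
      exact h5
    · rintro ⟨h3, h4⟩
      have hn : (0 : ℝ) < n := hs0.trans_le h3
      refine ⟨⟨by exact_mod_cast hs.trans_le h3, by exact_mod_cast h4.le.trans hs'⟩, ?_⟩
      rw [Nat.floor_eq_iff (hf.pos n hn).le, ← h2, ← h1]
      exact ⟨(hf.le_iff hs0 hn).2 h3, (hf.lt_iff hn (hs0.trans hss)).2 h4⟩
  rw [hits, hfil, Nat.card_Ico, Nat.cast_sub (Nat.ceil_mono hss.le),
    natCast_ceil_eq_intCast_ceil hs0.le, natCast_ceil_eq_intCast_ceil (hs0.trans hss).le]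

/-! ### A single window -/

theorem sum_tent_le {η : ℝ} (hη : 0 < η) {N : ℕ} (hN : 1 ≤ N) (hN2 : 1 ≤ N * η ^ 2)
    (W : Finset ℕ) (lam β : ℝ) :
    ∑ m ∈ W, tent η (lam * m + β) ≤ 6 * η * W.card +
      2 * ∑ h ∈ Finset.Icc 1 N, min (1 / (h : ℝ)) (2 * η) *
        (‖expSum 1 W (h * lam)‖ + ‖expSum 1 W (-(h * lam))‖) := by
  have key := norm_sum_ddiff_bern_le (ψ := 1) (W := W) (M := 1) (by simp) hN lam β (2 * η)
    (-(2 * η))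
  simp only [Pi.one_apply, one_mul] at key
  rw [← Complex.ofReal_sum, Complex.norm_real, abs_neg,
    abs_of_pos (by positivity : 0 < 2 * η)] at key
  have hN0 : (0 : ℝ) < N := by exact_mod_cast hN
  have h4 : 4 / (N : ℝ) ≤ 4 * η ^ 2 := by rw [div_le_iff₀ hN0]; nlinarith
  set X := ∑ h ∈ Finset.Icc 1 N, min (1 / (h : ℝ)) (2 * η) *
        (‖expSum 1 W (h * lam)‖ + ‖expSum 1 W (-(h * lam))‖)
  set D := ∑ m ∈ W, ddiff bern (2 * η) (-(2 * η)) (lam * m + β) with hD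
  have hsum : ∑ m ∈ W, tent η (lam * m + β) = 4 * η * W.card + D / (2 * η) := by
    simp only [tent, Finset.sum_add_distrib, Finset.sum_const, nsmul_eq_mul, hD, Finset.sum_div]
    ring
  have hDle : D ≤ 4 * η ^ 2 * W.card + 2 * (2 * η) * X :=
    (le_abs_self _).trans (key.trans (by gcongr))
  have : D / (2 * η) ≤ 2 * η * W.card + 2 * X := by
    rw [div_le_iff₀ (by positivity)]; nlinarith
  rw [hsum]; linarith

theorem norm_sum_saw_sub_saw_le {η M : ℝ} (hη : 0 < η) {N : ℕ} (hN : 1 ≤ N)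
    (hN2 : 1 ≤ N * η ^ 2) {φ : ℕ → ℂ} {W : Finset ℕ} (hφ : ∀ m ∈ W, ‖φ m‖ ≤ M) (hM : 0 ≤ M)
    (lam β p : ℝ) :
    ‖∑ m ∈ W, φ m * (saw η (lam * m + β + p) - saw η (lam * m + β) : ℝ)‖ ≤
      2 * η * (M * W.card) + ∑ h ∈ Finset.Icc 1 N, min (1 / (h : ℝ)) |p| *
        (‖expSum φ W (h * lam)‖ + ‖expSum φ W (-(h * lam))‖) := by
  have key := norm_sum_ddiff_bern_le hφ hN lam β p η
  rw [abs_of_pos hη] at key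
  have hN0 : (0 : ℝ) < N := by exact_mod_cast hN
  have h4 : 4 / (N : ℝ) ≤ 4 * η ^ 2 := by rw [div_le_iff₀ hN0]; nlinarith
  have hsum : ∑ m ∈ W, φ m * (saw η (lam * m + β + p) - saw η (lam * m + β) : ℝ) =
      ((1 / (2 * η) : ℝ) : ℂ) * ∑ m ∈ W, φ m * (ddiff bern p η (lam * m + β) : ℝ) := by
    rw [Finset.mul_sum]
    refine Finset.sum_congr rfl fun m _ => ?_
    rw [saw_sub_saw]; push_cast; ring
  rw [hsum, norm_mul, Complex.norm_real, Real.norm_eq_abs, abs_of_pos (by positivity),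
    one_div, inv_mul_le_iff₀ (by positivity)]
  refine key.trans ?_
  have : 4 / (N : ℝ) * (M * W.card) ≤ 4 * η ^ 2 * (M * W.card) := by gcongr
  linarith

/-- The even function of the frequency that dominates a window sum: the window suprema of `φ`, and
those of the constant `1` for the error made in smoothing. -/
noncomputable def majorant (a b z M : ℝ) (φ : ℕ → ℂ) (θ : ℝ) : ℝ :=
  windowSup a b z φ θ + windowSup a b z φ (-θ) +
    8 * M * (windowSup a b z 1 θ + windowSup a b z 1 (-θ))

section majorant

variable {a b z M : ℝ} {φ : ℕ → ℂ}

theorem majorant_nonneg (hz : 0 < z) (hM : 0 ≤ M) (θ : ℝ) : 0 ≤ majorant a b z M φ θ := by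
  have h := fun φ θ => windowSup_nonneg (a := a) (b := b) (φ := φ) hz θ
  have h1 := h φ θ
  have h2 := h φ (-θ)
  have h3 := h 1 θ
  have h4 := h 1 (-θ)
  unfold majorant
  positivity

theorem majorant_periodic : Function.Periodic (majorant a b z M φ) 1 := by
  intro θ
  have h : ∀ φ, windowSup a b z φ (-(θ + 1)) = windowSup a b z φ (-θ) := fun φ => by
    rw [← windowSup_periodic (-(θ + 1))]; ring_nf
  have h' : ∀ φ, windowSup a b z φ (θ + 1) = windowSup a b z φ θ := fun φ =>
    windowSup_periodic θ
  simp only [majorant, h, h']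

theorem continuous_majorant (ha : 0 ≤ a) (hz : 0 < z) (hφ : ∀ n, ‖φ n‖ ≤ 1) :
    Continuous (majorant a b z M φ) := by
  have h1 := continuous_windowSup (b := b) ha hz hφ
  have h2 := continuous_windowSup (φ := 1) (b := b) ha hz (by simp)
  unfold majorant
  fun_prop

theorem integral_windowSup_neg :
    ∫ θ in (0 : ℝ)..1, windowSup a b z φ (-θ) = ∫ θ in (0 : ℝ)..1, windowSup a b z φ θ := by
  rw [intervalIntegral.integral_comp_neg, neg_zero]
  have := (windowSup_periodic (a := a) (b := b) (z := z) (φ := φ)).intervalIntegral_add_eq (-1) 0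
  simpa using this

theorem integral_majorant_le (ha : 0 ≤ a) (hz : 1 ≤ z) (hM : 0 ≤ M) (hφ : ∀ n, ‖φ n‖ ≤ 1) :
    ∫ θ in (0 : ℝ)..1, majorant a b z M φ θ ≤
      2 * (∫ θ in (0 : ℝ)..1, windowSup a b z φ θ) + 128 * (M * (Real.log (1 + z) / z)) := by
  have hz0 : 0 < z := by linarith
  have c1 := continuous_windowSup (b := b) ha hz0 hφ
  have c2 := continuous_windowSup (φ := 1) (b := b) ha hz0 (by simp)
  have h1 := integral_windowSup_one_le (b := b) ha hz
  unfold majorant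
  rw [intervalIntegral.integral_add (Continuous.intervalIntegrable (by fun_prop) _ _)
      (Continuous.intervalIntegrable (by fun_prop) _ _),
    intervalIntegral.integral_add (Continuous.intervalIntegrable (by fun_prop) _ _)
      (Continuous.intervalIntegrable (by fun_prop) _ _), intervalIntegral.integral_const_mul,
    intervalIntegral.integral_add (Continuous.intervalIntegrable (by fun_prop) _ _)
      (Continuous.intervalIntegrable (by fun_prop) _ _), integral_windowSup_neg,
    integral_windowSup_neg]
  nlinarith [mul_le_mul_of_nonneg_left h1 hM]

end majorant

/-- On a window that starts at `x = f(t)`, the inverse function is replaced by its tangent, of slope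
`1 / f'(t)`. Then `m` is hit when a linear phase falls into an interval modulo `1`, and the smoothed
indicator of that interval is expanded into harmonics. -/
theorem Doubling.norm_sum_window_le {f : ℝ → ℝ} {c : ℝ} (hf : Doubling f c) {A : ℕ} (hA : 0 < A)
    {z η M : ℝ} (hz : 1 ≤ z) (hη : 0 < η) (hη1 : η ≤ 1 / 2) (hη2 : 2 * η ≤ (deriv f A)⁻¹)
    (hη3 : c * deriv (deriv f) A * (2 * z) ^ 2 / deriv f A ^ 3 ≤ η)
    {N : ℕ} (hN : 1 ≤ N) (hN2 : 1 ≤ N * η ^ 2)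
    {φ : ℕ → ℂ} (hφ : ∀ n, ‖φ n‖ ≤ 1) (hM : 0 ≤ M)
    (hφM : ∀ m ∈ intervalNat (f A) (f (2 * A)), ‖φ m‖ ≤ M)
    {x : ℝ} (hx : x ∈ Set.Ioc (f A) (f (2 * A) - z - 1)) :
    ‖∑ m ∈ intervalNat x (x + z), φ m * (hits f A m - (deriv f (inv f m))⁻¹ : ℝ)‖ ≤
      z * (58 * (M * η) + ∑ h ∈ Finset.Icc 1 N, min (1 / (h : ℝ)) (deriv f A)⁻¹ *
        majorant (f A) (f (2 * A)) z M φ (h * (deriv f (inv f x))⁻¹)) := by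
  have hadm := hf.admissible
  have hA0 : (0 : ℝ) < A := by exact_mod_cast hA
  have hP := hadm.deriv_pos A hA0
  have hQ := hadm.deriv_deriv_pos A hA0
  have hc := hf.one_le
  have hfA := (hadm.pos A hA0).le
  have hz0 : 0 < z := by linarith
  obtain ⟨t, ht1, ht2, rfl⟩ := hadm.exists_eq_of_mem hA0 (by linarith : (A : ℝ) ≤ 2 * A) hx.1.le
    (by linarith [hx.2])
  have ht0 : 0 < t := hA0.trans_le ht1
  rw [hadm.inv_apply ht0]
  set a := f A
  set b := f (2 * A)
  set W := intervalNat (f t) (f t + z) with hW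
  set P := deriv f A
  set Q := deriv (deriv f) A
  set lam := (deriv f t)⁻¹ with hlam
  have hDt := hadm.deriv_pos t ht0
  have hlam0 : 0 < lam := inv_pos.2 hDt
  have hlamP : lam ≤ P⁻¹ := inv_anti₀ hP (hadm.deriv_mono hA0 ht1)
  set β := t - lam * f t with hβ
  -- the tangent line at `t` takes the value `lam * y + β` at `y`
  have hlin : ∀ y : ℝ, f t ≤ y → y ≤ f t + z + 1 → ∃ s, t ≤ s ∧ s ≤ 2 * A ∧ f s = y ∧
      |(⌈s⌉ : ℝ) - (lam * y + β + 1 / 2 + saw η (-(lam * y + β)))| ≤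
        η + 2 * tent η (lam * y + β) ∧ |lam - (deriv f s)⁻¹| ≤ η := by
    intro y hy1 hy2
    obtain ⟨s, hs1, hs2, rfl⟩ := hadm.exists_eq_of_mem ht0 ht2 hy1 (by linarith [hx.2])
    obtain ⟨l1, l2, l3⟩ := hf.linearization hA0 ht1 hs1 hs2 (by linarith : f s - f t ≤ 2 * z)
    have hl : t + (f s - f t) / deriv f t = lam * f s + β := by
      rw [hβ, hlam]; field_simp; ring
    rw [hl] at l1 l2
    refine ⟨s, hs1, hs2, rfl, abs_ceil_sub_le hη hη1 (by linarith) l1, l3.trans (le_trans ?_ hη3)⟩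
    gcongr
    nlinarith
  have hmW : ∀ m ∈ W, f t < m ∧ (m : ℝ) ≤ f t + z := fun m hm =>
    (mem_intervalNat (hadm.pos t ht0).le (by linarith [hadm.pos t ht0]) m).1 hm
  have hφW : ∀ m ∈ W, ‖φ m‖ ≤ M := by
    intro m hm
    obtain ⟨h1, h2⟩ := hmW m hm
    refine hφM m ?_
    rw [mem_intervalNat hfA (by linarith [hx.2, hx.1])]
    exact ⟨by linarith [hx.1], by linarith [hx.2]⟩
  -- replacing the indicator by the smoothed one, for a single `m`
  have hterm : ∀ m ∈ W, |(hits f A m - (deriv f (inv f m))⁻¹ : ℝ) -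
      (saw η (-lam * m + -β + -lam) - saw η (-lam * m + -β))| ≤
        3 * η + 2 * tent η (lam * m + β) + 2 * tent η (lam * m + (β + lam)) := by
    intro m hm
    obtain ⟨h1, h2⟩ := hmW m hm
    obtain ⟨s, hs1, hs2, hs3, hs4, hs5⟩ := hlin m h1.le (by linarith)
    obtain ⟨s', hs1', hs2', hs3', hs4', -⟩ := hlin (m + 1) (by linarith) (by linarith)
    have hs0 : 0 < s := ht0.trans_le hs1
    have hts : t < s := by
      rw [← hadm.lt_iff ht0 hs0, hs3]; exact h1
    have hss : s < s' := by
      rw [← hadm.lt_iff hs0 (ht0.trans_le hs1'), hs3, hs3']; linarith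
    rw [hadm.hits_eq hA (ht1.trans_lt hts) hs2' hss hs3 hs3', ← hs3, hadm.inv_apply hs0, hs3]
    rw [show lam * ((m : ℝ) + 1) + β = lam * m + (β + lam) by ring,
      show -(lam * (m : ℝ) + (β + lam)) = -lam * m + -β + -lam by ring] at hs4'
    rw [show -(lam * (m : ℝ) + β) = -lam * m + -β by ring] at hs4
    rw [abs_le] at *
    constructor <;> linarith
  have hcard : (W.card : ℝ) ≤ 2 * z :=
    (card_intervalNat_le (hadm.pos t ht0).le hz0.le).trans (by linarith)
  have hS : ∀ θ, ‖expSum φ W θ‖ ≤ z * windowSup a b z φ θ := fun θ =>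
    norm_expSum_le_windowSup hfA hz0 hφ ⟨hx.1, by linarith [hx.2]⟩ θ
  have hS1 : ∀ θ, ‖expSum 1 W θ‖ ≤ z * windowSup a b z 1 θ := fun θ =>
    norm_expSum_le_windowSup hfA hz0 (by simp) ⟨hx.1, by linarith [hx.2]⟩ θ
  have hsaw := norm_sum_saw_sub_saw_le hη hN hN2 hφW hM (-lam) (-β) (-lam)
  have htent := fun β' => sum_tent_le hη hN hN2 W lam β'
  rw [abs_neg, abs_of_pos hlam0] at hsaw
  set w : ℕ → ℝ := fun h => min (1 / (h : ℝ)) P⁻¹ with hw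
  have hw0 : ∀ h, 0 ≤ w h := fun h => le_min (by positivity) (by positivity)
  set X := ∑ h ∈ Finset.Icc 1 N, w h *
    (windowSup a b z φ (h * lam) + windowSup a b z φ (-(h * lam))) with hX
  set X1 := ∑ h ∈ Finset.Icc 1 N, w h *
    (windowSup a b z 1 (h * lam) + windowSup a b z 1 (-(h * lam))) with hX1
  have hXle : ∑ h ∈ Finset.Icc 1 N, min (1 / (h : ℝ)) lam *
      (‖expSum φ W (h * -lam)‖ + ‖expSum φ W (-(h * -lam))‖) ≤ z * X := by
    rw [hX, Finset.mul_sum]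
    refine Finset.sum_le_sum fun h _ => ?_
    have e1 := hS (h * lam)
    have e2 := hS (-(h * lam))
    rw [mul_neg, neg_neg]
    calc _ ≤ w h * (‖expSum φ W (-(h * lam))‖ + ‖expSum φ W (h * lam)‖) := by
          gcongr; exact min_le_min le_rfl hlamP
      _ ≤ w h * (z * windowSup a b z φ (-(h * lam)) + z * windowSup a b z φ (h * lam)) :=
          mul_le_mul_of_nonneg_left (add_le_add e2 e1) (hw0 h)
      _ = _ := by ring
  have hX1le : ∑ h ∈ Finset.Icc 1 N, min (1 / (h : ℝ)) (2 * η) *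
      (‖expSum 1 W (h * lam)‖ + ‖expSum 1 W (-(h * lam))‖) ≤ z * X1 := by
    rw [hX1, Finset.mul_sum]
    refine Finset.sum_le_sum fun h _ => ?_
    have e1 := hS1 (h * lam)
    have e2 := hS1 (-(h * lam))
    calc _ ≤ w h * (‖expSum 1 W (h * lam)‖ + ‖expSum 1 W (-(h * lam))‖) := by
          gcongr; exact min_le_min le_rfl hη2
      _ ≤ w h * (z * windowSup a b z 1 (h * lam) + z * windowSup a b z 1 (-(h * lam))) :=
          mul_le_mul_of_nonneg_left (add_le_add e1 e2) (hw0 h)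
      _ = _ := by ring
  have hmaj : ∑ h ∈ Finset.Icc 1 N, w h * majorant a b z M φ (h * lam) = X + 8 * M * X1 := by
    rw [hX, hX1, Finset.mul_sum, ← Finset.sum_add_distrib]
    exact Finset.sum_congr rfl fun h _ => by rw [majorant]; ring
  have hsplit : ∑ m ∈ W, φ m * (hits f A m - (deriv f (inv f m))⁻¹ : ℝ) =
      ∑ m ∈ W, φ m * (saw η (-lam * m + -β + -lam) - saw η (-lam * m + -β) : ℝ) +
      ∑ m ∈ W, φ m * (((hits f A m - (deriv f (inv f m))⁻¹ : ℝ) -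
        (saw η (-lam * m + -β + -lam) - saw η (-lam * m + -β)) : ℝ) : ℂ) := by
    rw [← Finset.sum_add_distrib]
    exact Finset.sum_congr rfl fun m _ => by push_cast; ring
  have herr : ‖∑ m ∈ W, φ m * (((hits f A m - (deriv f (inv f m))⁻¹ : ℝ) -
      (saw η (-lam * m + -β + -lam) - saw η (-lam * m + -β)) : ℝ) : ℂ)‖ ≤
      M * (27 * η * W.card + 8 * (z * X1)) := by
    calc _ ≤ ∑ m ∈ W, M * (3 * η + 2 * tent η (lam * m + β) +
          2 * tent η (lam * m + (β + lam))) := by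
          refine (norm_sum_le _ _).trans (Finset.sum_le_sum fun m hm => ?_)
          rw [norm_mul, Complex.norm_real, Real.norm_eq_abs]
          exact mul_le_mul (hφW m hm) (hterm m hm) (abs_nonneg _) hM
      _ = M * (3 * η * W.card + 2 * ∑ m ∈ W, tent η (lam * m + β) +
          2 * ∑ m ∈ W, tent η (lam * m + (β + lam))) := by
          rw [← Finset.mul_sum, Finset.sum_add_distrib, Finset.sum_add_distrib, Finset.sum_const,
            nsmul_eq_mul, ← Finset.mul_sum, ← Finset.mul_sum]
          ring
      _ ≤ _ := by
          refine mul_le_mul_of_nonneg_left ?_ hM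
          have t1 := htent β
          have t2 := htent (β + lam)
          linarith
  rw [hsplit, hmaj]
  refine (norm_add_le _ _).trans ((add_le_add hsaw herr).trans ?_)
  have hcM : M * η * W.card ≤ M * η * (2 * z) := by gcongr
  linarith

/-! ### The discrepancy -/

theorem sum_Icc_one_div_le (N : ℕ) : ∑ h ∈ Finset.Icc 1 N, 1 / (h : ℝ) ≤ 1 + Real.log N := by
  have := harmonic_le_one_add_log N
  rw [harmonic_eq_sum_Icc] at this
  push_cast at this
  simpa only [one_div] using this

/-- The difference between the two sums, before normalization. -/
noncomputable def discrepancy (f : ℝ → ℝ) (φ : ℕ → ℂ) (A : ℕ) : ℂ :=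
  ∑ m ∈ intervalNat (f A) (f (2 * A)), φ m * (hits f A m - (deriv f (inv f m))⁻¹ : ℝ)

theorem Admissible.exists_eq_of_mem_intervalNat {f : ℝ → ℝ} (hf : Admissible f) {A : ℝ}
    (hA : 0 < A) {m : ℕ} (hm : m ∈ intervalNat (f A) (f (2 * A))) :
    ∃ s, A ≤ s ∧ s ≤ 2 * A ∧ f s = m := by
  rw [mem_intervalNat (hf.pos _ hA).le (hf.pos _ (by positivity)).le] at hm
  exact hf.exists_eq_of_mem hA (by linarith) hm.1.le hm.2

theorem Admissible.sub_eq_discrepancy {f : ℝ → ℝ} (hf : Admissible f) {A : ℕ} (hA : 0 < A)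
    (hP : 1 ≤ deriv f A) (φ : ℕ → ℂ) :
    ∑ n ∈ Finset.Ioc A (2 * A), φ ⌊f n⌋₊ - ∑ m ∈ intervalNat (f A) (f (2 * A)),
      φ m * ((deriv (inv f) m : ℝ) : ℂ) = discrepancy f φ A := by
  have hA' : (0 : ℝ) < A := by exact_mod_cast hA
  rw [hf.sum_floor_eq hA hP, ← Finset.sum_sub_distrib, discrepancy]
  refine Finset.sum_congr rfl fun m hm => ?_
  obtain ⟨s, h1, -, h2⟩ := hf.exists_eq_of_mem_intervalNat hA' hm
  have hs : 0 < s := hA'.trans_le h1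
  rw [← h2, (hf.hasDerivAt_inv hs).deriv, hf.inv_apply hs]
  push_cast; ring

theorem Admissible.slope_le {f : ℝ → ℝ} (hf : Admissible f) {A : ℝ} (hA : 0 < A) {m : ℕ}
    (hm : m ∈ intervalNat (f A) (f (2 * A))) :
    0 ≤ (deriv f (inv f m))⁻¹ ∧ (deriv f (inv f m))⁻¹ ≤ (deriv f A)⁻¹ := by
  obtain ⟨s, h1, -, h2⟩ := hf.exists_eq_of_mem_intervalNat hA hm
  have hs : 0 < s := hA.trans_le h1
  rw [← h2, hf.inv_apply hs]
  exact ⟨(inv_pos.2 (hf.deriv_pos s hs)).le,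
    inv_anti₀ (hf.deriv_pos A hA) (hf.deriv_mono hA h1)⟩

theorem Doubling.sub_le {f : ℝ → ℝ} {c : ℝ} (hf : Doubling f c) {A : ℝ} (hA : 0 < A) :
    f (2 * A) - f A ≤ (1 + 2 * c ^ 2) * deriv f A * A := by
  refine (hf.admissible.sub_le_deriv_mul hA (by linarith)).trans ?_
  have := hf.deriv_two_mul_le hA
  rw [show 2 * A - A = A by ring]
  gcongr

/-- The trivial estimate: both sums have total weight `O(A)`. -/
theorem Doubling.norm_discrepancy_le {f : ℝ → ℝ} {c : ℝ} (hf : Doubling f c) {A : ℕ} (hA : 0 < A)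
    (hP : 1 ≤ deriv f A) {φ : ℕ → ℂ} {M : ℝ} (hM : 0 ≤ M)
    (hφM : ∀ m ∈ intervalNat (f A) (f (2 * A)), ‖φ m‖ ≤ M) :
    1 / (A : ℝ) * ‖discrepancy f φ A‖ ≤ (3 + 2 * c ^ 2) * M := by
  have hadm := hf.admissible
  have hA0 : (0 : ℝ) < A := by exact_mod_cast hA
  have hA1 : (1 : ℝ) ≤ A := by exact_mod_cast hA
  have hcount : ∑ m ∈ intervalNat (f A) (f (2 * A)), (hits f A m : ℝ) = A := by
    have := hadm.sum_floor_eq hA hP 1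
    simp only [Pi.one_apply, one_mul, Finset.sum_const, Nat.card_Ioc, nsmul_eq_mul, mul_one] at this
    rw [show 2 * A - A = A by omega] at this
    exact_mod_cast this.symm
  have hcard : ((intervalNat (f A) (f (2 * A))).card : ℝ) ≤ (1 + 2 * c ^ 2) * deriv f A * A + 1 := by
    have h1 := hf.sub_le hA0
    have h0 := hadm.deriv_mul_le_sub hA0 (by linarith : (A : ℝ) ≤ 2 * A)
    have h2 := card_intervalNat_le (hadm.pos A hA0).le (z := f (2 * A) - f A) (by nlinarith)
    rw [add_sub_cancel] at h2
    linarith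
  have hPi : (deriv f A)⁻¹ ≤ 1 := inv_le_one_of_one_le₀ hP
  have hP0 : 0 < deriv f A := by linarith
  rw [one_div, inv_mul_le_iff₀ hA0]
  calc ‖discrepancy f φ A‖
      ≤ ∑ m ∈ intervalNat (f A) (f (2 * A)), M * (hits f A m + (deriv f A)⁻¹) := by
        refine (norm_sum_le _ _).trans (Finset.sum_le_sum fun m hm => ?_)
        rw [norm_mul, Complex.norm_real, Real.norm_eq_abs]
        obtain ⟨h1, h2⟩ := hadm.slope_le hA0 hm
        refine mul_le_mul (hφM m hm) ?_ (abs_nonneg _) hM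
        have : (0 : ℝ) ≤ hits f A m := Nat.cast_nonneg _
        rw [abs_le]; constructor <;> linarith
    _ = M * (A + (intervalNat (f A) (f (2 * A))).card * (deriv f A)⁻¹) := by
        rw [← Finset.mul_sum, Finset.sum_add_distrib, hcount, Finset.sum_const, nsmul_eq_mul]
    _ ≤ M * (A + ((1 + 2 * c ^ 2) * deriv f A * A + 1) * (deriv f A)⁻¹) := by gcongr
    _ = M * (A + (1 + 2 * c ^ 2) * A + (deriv f A)⁻¹) := by field_simp; ring
    _ ≤ M * (A + (1 + 2 * c ^ 2) * A + A) := by gcongr; linarith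
    _ = A * ((3 + 2 * c ^ 2) * M) := by ring

/-- Consequences of the smallness conditions: the windows are longer than the average gap `P` and
short against the whole range; the second uses the lower bound for `f''`, here `hPK`. -/
theorem window_size {A P Q L K z ε : ℝ} (hA : 0 < A) (hP : 0 < P) (hL : 1 / 2 ≤ L) (hK : 0 < K)
    (hz : 0 < z) (hP1 : 1 ≤ P) (hε : 0 < ε) (hε16 : ε ≤ 1 / 16) (hεK : ε * K ≤ 1 / 8)
    (hPK : P ≤ K * (A * Q * L)) (hQ : 0 < Q) (h1 : Q / P ^ 2 * z ^ 2 ≤ ε)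
    (h2 : P * L ^ 3 / z ≤ ε) :
    P ≤ 8 * ε * z ∧ 1 ≤ z ∧ z ≤ A * (Q / P ^ 2 * z ^ 2) ∧ 2 * z ≤ A := by
  set X := Q / P ^ 2 * z ^ 2 with hX
  have hX0 : 0 ≤ X := by positivity
  have hL0 : 0 < L := by linarith
  have hL2 : 1 / 4 ≤ L ^ 2 := by nlinarith
  have hL3 : 1 / 8 ≤ L ^ 3 := by
    calc (1 / 8 : ℝ) = 1 / 4 * (1 / 2) := by norm_num
      _ ≤ L ^ 2 * L := by gcongr
      _ = L ^ 3 := by ring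
  have hPLz : P * L ^ 3 ≤ ε * z := by rwa [div_le_iff₀ hz] at h2
  have hPz : P ≤ 8 * ε * z := by
    have := mul_le_mul_of_nonneg_left hL3 hP.le
    linarith
  have hεz : ε * z ≤ 1 / 16 * z := by gcongr
  have hPL : P * L ≤ 4 * ε * z := by
    have := mul_le_mul_of_nonneg_left hL2 (mul_pos hP hL0).le
    linarith
  have hzA : z ≤ 4 * (ε * K) * (A * X) := by
    have e1 : z ^ 2 * P ≤ K * A * L * (X * P ^ 2) := by
      have : X * P ^ 2 = Q * z ^ 2 := by rw [hX]; field_simp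
      rw [this]
      linarith [mul_le_mul_of_nonneg_left hPK (sq_nonneg z)]
    have e2 : z ^ 2 ≤ K * A * X * (P * L) := by
      have : z ^ 2 * P ≤ (K * A * X * (P * L)) * P := by linarith
      exact le_of_mul_le_mul_right this hP
    have e3 : z ^ 2 ≤ K * A * X * (4 * ε * z) :=
      e2.trans (mul_le_mul_of_nonneg_left hPL (by positivity))
    have : z * z ≤ (4 * (ε * K) * (A * X)) * z := by linarith
    exact le_of_mul_le_mul_right this hz
  have hAX : 0 ≤ A * X := by positivity
  have hzA' : z ≤ 1 / 2 * (A * X) := by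
    have := mul_le_mul_of_nonneg_right hεK hAX
    linarith
  have hAXA : A * X ≤ A * (1 / 16) := by gcongr; linarith
  exact ⟨hPz, by linarith, by linarith, by linarith⟩

/-- One harmonic: the two terms of the slope average are balanced by the two bounds for the
weight `min(1/h, 1/f'(A))`. -/
theorem Doubling.weight_mul_integral_comp_slope_le {f : ℝ → ℝ} {c : ℝ} (hf : Doubling f c)
    {R : ℝ → ℝ} (hc : Continuous R) (hp : Function.Periodic R 1) (h0 : ∀ θ, 0 ≤ R θ)
    {A b h L K : ℝ} (hA : 0 < A) (hAb : A ≤ b) (hb : b ≤ 2 * A) (hh : 0 < h) (hL : 0 ≤ L)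
    (hK : 0 ≤ K) (hPK : deriv f A ≤ K * (A * deriv (deriv f) A * L)) :
    min (1 / h) (deriv f A)⁻¹ * ∫ x in (f A)..(f b), R (h * (deriv f (inv f x))⁻¹) ≤
      2 * (1 + 2 * c ^ 2) ^ 3 * (A * deriv f A) * (c + K * L) * (∫ θ in (0 : ℝ)..1, R θ) *
        (1 / h) := by
  have hIR0 : 0 ≤ ∫ θ in (0 : ℝ)..1, R θ :=
    intervalIntegral.integral_nonneg zero_le_one fun θ _ => h0 θ
  have key := hf.integral_comp_slope_le hc hp h0 hA hAb hb hh
  have hP := hf.admissible.deriv_pos A hA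
  have hQ := hf.admissible.deriv_deriv_pos A hA
  have hc1 := hf.one_le
  set IR := ∫ θ in (0 : ℝ)..1, R θ
  set P := deriv f A
  set Q := deriv (deriv f) A
  set B := 1 + 2 * c ^ 2
  set w := min (1 / h) P⁻¹
  have hw0 : 0 ≤ w := le_min (by positivity) (by positivity)
  have hw1 : w ≤ 1 / h := min_le_left _ _
  have hw2 : w * P ≤ 1 := by
    have : w ≤ P⁻¹ := min_le_right _ _
    calc w * P ≤ P⁻¹ * P := by gcongr
      _ = 1 := inv_mul_cancel₀ hP.ne'
  have hPQ : P / Q ≤ K * (A * L) := by rw [div_le_iff₀ hQ]; linarith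
  refine (mul_le_mul_of_nonneg_left key hw0).trans ?_
  calc w * (2 * B ^ 3 * P ^ 3 / (h * Q) * (h * (c * (A * Q)) / P ^ 2 + 1) * IR)
      = 2 * B ^ 3 * IR * (c * (A * P) * w + (P / Q) * (w * P) * P * (1 / h)) := by
        field_simp
    _ ≤ 2 * B ^ 3 * IR * (c * (A * P) * (1 / h) + (K * (A * L)) * 1 * P * (1 / h)) := by
        gcongr
    _ = _ := by ring

/-- The windows are averaged over their starting points. -/
theorem Doubling.norm_discrepancy_le_integral_majorant {f : ℝ → ℝ} {c K : ℝ} (hf : Doubling f c)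
    (hK : 0 ≤ K) {A : ℕ} (hA : 2 ≤ A) (hP : 1 ≤ deriv f A)
    (hKA : deriv f A ≤ K * (A * deriv (deriv f) A * Real.log A))
    {φ : ℕ → ℂ} (hφ : ∀ n, ‖φ n‖ ≤ 1) {M z η : ℝ} (hM : 0 ≤ M) (hz1 : 1 ≤ z) (hzA : 2 * z ≤ A)
    (hφM : ∀ m ∈ intervalNat (f A) (f (2 * A)), ‖φ m‖ ≤ M)
    (hηz : 1 / z ≤ η) (hη2 : 2 * η ≤ (deriv f A)⁻¹)
    (hη3 : c * deriv (deriv f) A * (2 * z) ^ 2 / deriv f A ^ 3 ≤ η) :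
    ‖discrepancy f φ A‖ ≤ 58 * (M * η) * ((1 + 2 * c ^ 2) * deriv f A * A) +
      2 * (1 + 2 * c ^ 2) ^ 3 * (A * deriv f A) * (c + K * Real.log A) *
        (∫ θ in (0 : ℝ)..1, majorant (f A) (f (2 * A)) z M φ θ) * (4 * Real.log A) +
      M * (5 * z) := by
  have hadm := hf.admissible
  have hc := hf.one_le
  have hA2 : (2 : ℝ) ≤ A := by exact_mod_cast hA
  have hA0 : (0 : ℝ) < A := by linarith
  have hL : 1 / 2 ≤ Real.log A := by
    have h := Real.log_le_log (by norm_num) hA2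
    have := Real.log_two_gt_d9
    linarith
  have hz : 0 < z := by linarith
  have hBs := hf.sub_le hA0
  have hlow := hadm.deriv_mul_le_sub hA0 (by linarith : (A : ℝ) ≤ 2 * A)
  have hfA := (hadm.pos A hA0).le
  have hη0 : 0 < η := lt_of_lt_of_le (by positivity) hηz
  have hη1 : η ≤ 1 / 2 := by
    have := inv_le_one_of_one_le₀ hP
    linarith
  have hab : f A ≤ f (2 * A) - z - 1 := by
    have := mul_le_mul_of_nonneg_right hP hA0.le
    linarith
  obtain ⟨b, hb1, hb2, hb⟩ := hadm.exists_eq_of_mem hA0 (by linarith : (A : ℝ) ≤ 2 * A) hab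
    (by linarith)
  -- this many harmonics make the truncation error of the Fourier series at most `O(η)`
  set N := ⌈z ^ 2⌉₊ with hN
  have hNz : z ^ 2 ≤ N := Nat.le_ceil _
  have hN1 : 1 ≤ N := Nat.one_le_ceil_iff.2 (by positivity)
  have hN2 : 1 ≤ N * η ^ 2 := by
    calc (1 : ℝ) = z ^ 2 * (1 / z) ^ 2 := by field_simp
      _ ≤ _ := by gcongr
  have hlogN : 1 + Real.log N ≤ 4 * Real.log A := by
    have e1 : (N : ℝ) ≤ (A : ℝ) ^ 2 := by
      have := (Nat.ceil_lt_add_one (by positivity : 0 ≤ z ^ 2)).le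
      nlinarith
    have e2 := Real.log_le_log (by exact_mod_cast hN1) e1
    rw [Real.log_pow] at e2
    push_cast at e2
    linarith
  set R := majorant (f A) (f (2 * A)) z M φ with hR
  have hRc : Continuous R := continuous_majorant hfA hz hφ
  have hRp : Function.Periodic R 1 := majorant_periodic
  have hR0 : ∀ θ, 0 ≤ R θ := majorant_nonneg hz hM
  have hIR0 : 0 ≤ ∫ θ in (0 : ℝ)..1, R θ :=
    intervalIntegral.integral_nonneg zero_le_one fun θ _ => hR0 θ
  have hRs : ∀ h : ℕ, IntervalIntegrable
      (fun x => min (1 / (h : ℝ)) (deriv f A)⁻¹ * R (h * (deriv f (inv f x))⁻¹))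
      MeasureTheory.volume (f A) (f b) := fun h =>
    (continuousOn_const.mul (hRc.comp_continuousOn (continuousOn_const.mul
      (hadm.continuousOn_slope hA0 hb1)))).intervalIntegrable
  have hRsum : IntervalIntegrable (fun x => ∑ h ∈ Finset.Icc 1 N,
      min (1 / (h : ℝ)) (deriv f A)⁻¹ * R (h * (deriv f (inv f x))⁻¹))
      MeasureTheory.volume (f A) (f b) := by
    simpa only [Finset.sum_fn] using IntervalIntegrable.sum (Finset.Icc 1 N) fun h _ => hRs h
  have hbound : ‖∫ x in (f A)..(f (2 * A) - z - 1), ∑ m ∈ intervalNat x (x + z),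
      φ m * (hits f A m - (deriv f (inv f m))⁻¹ : ℝ)‖ ≤
      z * (58 * (M * η) * ((1 + 2 * c ^ 2) * deriv f A * A) +
        2 * (1 + 2 * c ^ 2) ^ 3 * (A * deriv f A) * (c + K * Real.log A) *
        (∫ θ in (0 : ℝ)..1, R θ) * (4 * Real.log A)) := by
    have e0 := intervalIntegral.norm_integral_le_of_norm_le hab
      (Filter.Eventually.of_forall fun x hx =>
        hf.norm_sum_window_le (by omega) hz1 hη0 hη1 hη2 hη3 hN1 hN2 hφ hM hφM hx)
      (μ := MeasureTheory.volume) (by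
        rw [← hb]
        exact (intervalIntegrable_const.add hRsum).const_mul z)
    refine e0.trans ?_
    rw [← hb, intervalIntegral.integral_const_mul, intervalIntegral.integral_add
      intervalIntegrable_const hRsum, intervalIntegral.integral_const,
      intervalIntegral.integral_finsetSum fun h _ => hRs h, smul_eq_mul]
    refine mul_le_mul_of_nonneg_left (add_le_add ?_ ?_) hz.le
    · rw [mul_comm]
      refine mul_le_mul_of_nonneg_left ?_ (by positivity)
      linarith
    · refine (Finset.sum_le_sum fun h hh => ?_).trans (((Finset.mul_sum _ _ _).symm).le.trans
        (mul_le_mul_of_nonneg_left ((sum_Icc_one_div_le N).trans hlogN) (by positivity)))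
      rw [intervalIntegral.integral_const_mul]
      exact hf.weight_mul_integral_comp_slope_le hRc hRp hR0 hA0 hb1 hb2
        (by exact_mod_cast (Finset.mem_Icc.1 hh).1) (by linarith) hK hKA
  have havg := mul_norm_sum_le_integral_window (b := f (2 * A)) (M := M)
    (F := fun m => φ m * (hits f A m - (deriv f (inv f m))⁻¹ : ℝ)) hfA hz1 hab (fun m hm => by
      rw [norm_mul, Complex.norm_real, Real.norm_eq_abs]
      obtain ⟨s1, s2⟩ := hadm.slope_le hA0 hm
      have s3 := inv_le_one_of_one_le₀ hP
      have s4 : (hits f A m : ℝ) ≤ 1 := by exact_mod_cast hadm.hits_le_one (by omega) hP m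
      have s5 : (0 : ℝ) ≤ hits f A m := Nat.cast_nonneg _
      have s6 : |(hits f A m : ℝ) - (deriv f (inv f m))⁻¹| ≤ 1 := by
        rw [abs_le]; constructor <;> linarith
      exact (mul_le_mul (hφM m hm) s6 (abs_nonneg _) hM).trans_eq (mul_one M)) hM
  refine le_of_mul_le_mul_left (havg.trans ?_) hz
  rw [mul_add z (_ + _)]
  exact add_le_add hbound le_rfl

/-- The estimate when both terms of the bound are small, where `M` bounds `φ` on the range
and `I` is the integral of the window suprema. -/
theorem Doubling.norm_discrepancy_le_of_small {f : ℝ → ℝ} {c K : ℝ} (hf : Doubling f c) (hK : 0 < K)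
    {A : ℕ} (hA : 2 ≤ A) (hP : 1 ≤ deriv f A)
    (hKA : deriv f A ≤ K * (A * deriv (deriv f) A * Real.log A))
    {φ : ℕ → ℂ} (hφ : ∀ n, ‖φ n‖ ≤ 1) {M z I : ℝ} (hM : 0 ≤ M) (hz : 0 < z)
    (hφM : ∀ m ∈ intervalNat (f A) (f (2 * A)), ‖φ m‖ ≤ M)
    (hI : I = ∫ θ in (0 : ℝ)..1, windowSup (f A) (f (2 * A)) z φ θ) (hMI : M / z ≤ I)
    (h1 : deriv (deriv f) A / deriv f A ^ 2 * z ^ 2 ≤ 1 / (8 * c + 16 + 8 * K))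
    (h2 : deriv f A * Real.log A ^ 3 / z ≤ 1 / (8 * c + 16 + 8 * K)) :
    1 / (A : ℝ) * ‖discrepancy f φ A‖ ≤
      (232 * (1 + 2 * c ^ 2) * c + 20) * (M * (deriv (deriv f) A / deriv f A ^ 2 * z ^ 2)) +
      (464 * (1 + 2 * c ^ 2) + 1056 * (1 + 2 * c ^ 2) ^ 3 * (2 * c + K)) *
        (deriv f A * Real.log A ^ 3 * I) := by
  have hc := hf.one_le
  have hA2 : (2 : ℝ) ≤ A := by exact_mod_cast hA
  have hA0 : (0 : ℝ) < A := by linarith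
  have hQ := hf.admissible.deriv_deriv_pos A hA0
  have hfA := (hf.admissible.pos A hA0).le
  have hL : 1 / 2 ≤ Real.log A := by
    have h := Real.log_le_log (by norm_num) hA2
    have := Real.log_two_gt_d9
    linarith
  have hI0 : 0 ≤ I := le_trans (by positivity) hMI
  have hmain := fun η hz1 hzA => hf.norm_discrepancy_le_integral_majorant hK.le hA hP hKA hφ
    (z := z) (η := η) hM hz1 hzA hφM
  have hmaj := fun hz1 : 1 ≤ z => integral_majorant_le (b := f (2 * A)) hfA hz1 hM hφ
  rw [← hI] at hmaj
  have hIR0 : 0 ≤ ∫ θ in (0 : ℝ)..1, majorant (f A) (f (2 * A)) z M φ θ :=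
    intervalIntegral.integral_nonneg zero_le_one fun θ _ => majorant_nonneg hz hM θ
  set IR := ∫ θ in (0 : ℝ)..1, majorant (f A) (f (2 * A)) z M φ θ
  set D := ‖discrepancy f φ A‖
  clear_value IR D
  set P := deriv f A
  set Q := deriv (deriv f) A
  set ε := 1 / (8 * c + 16 + 8 * K) with hε
  have hP0 : 0 < P := by linarith
  have hε0 : 0 < ε := by positivity
  have hεc : 8 * (c * ε) + 16 * ε + 8 * (ε * K) = 1 := by rw [hε]; field_simp
  have hcε : 0 < c * ε := by positivity
  have hKε : 0 < ε * K := by positivity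
  obtain ⟨hPz, hz1, hzAX, hzA⟩ := window_size hA0 hP0 hL hK hz hP hε0 (by linarith) (by linarith)
    hKA hQ h1 h2
  clear_value ε P Q
  have hlogz : Real.log (1 + z) ≤ Real.log A := Real.log_le_log (by positivity) (by linarith)
  have hIR : IR ≤ 132 * (Real.log A * I) := by
    have e2 : M * (Real.log (1 + z) / z) ≤ Real.log A * I := by
      calc M * (Real.log (1 + z) / z) = Real.log (1 + z) * (M / z) := by ring
        _ ≤ Real.log A * I := mul_le_mul hlogz hMI (by positivity) (by linarith)
    have := mul_le_mul_of_nonneg_right hL hI0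
    linarith [hmaj hz1]
  set L := Real.log A
  clear_value L
  set X := Q / P ^ 2 * z ^ 2 with hX
  have hX0 : 0 ≤ X := by positivity
  have hη3 : c * Q * (2 * z) ^ 2 / P ^ 3 = 4 * c * (X / P) := by rw [hX]; field_simp; ring
  rw [hη3] at hmain
  clear_value X
  have hL3 : 1 / 8 ≤ L ^ 3 := by
    calc (1 / 8 : ℝ) = (1 / 2) ^ 3 := by norm_num
      _ ≤ L ^ 3 := by gcongr
  have hP8 : P / z ≤ 8 * ε := by rw [div_le_iff₀ hz]; exact hPz
  have hPzL : P / z ≤ 8 * (P * L ^ 3 / z) := by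
    rw [← mul_div_assoc]
    gcongr
    have := mul_le_mul_of_nonneg_left hL3 hP0.le
    linarith
  have hηP : (4 * c * (X / P) + 1 / z) * P = 4 * c * X + P / z := by field_simp
  have hD := hmain (4 * c * (X / P) + 1 / z) hz1 hzA
    (by linarith [show 0 ≤ 4 * c * (X / P) by positivity]) (by
      rw [← one_div, le_div_iff₀ hP0, mul_assoc, hηP]
      have := mul_le_mul_of_nonneg_left h1 (by linarith : 0 ≤ c)
      linarith) (by linarith [show 0 ≤ 1 / z by positivity])
  set η := 4 * c * (X / P) + 1 / z
  clear_value η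
  clear hmain hmaj
  have t1 : M * η * P ≤ 4 * c * (M * X) + 8 * (P * L ^ 3 * I) := by
    have e1 : M * (P * L ^ 3 / z) ≤ P * L ^ 3 * I := by
      calc M * (P * L ^ 3 / z) = P * L ^ 3 * (M / z) := by ring
        _ ≤ _ := by gcongr
    have e2 := mul_le_mul_of_nonneg_left hPzL hM
    rw [mul_assoc, hηP]
    linarith
  have t2 : (c + K * L) * IR * L ≤ 132 * (2 * c + K) * (L ^ 3 * I) := by
    have hL0 : 0 ≤ L := by linarith
    have e1 : c + K * L ≤ (2 * c + K) * L := by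
      have := mul_le_mul_of_nonneg_left hL (by linarith : 0 ≤ c)
      linarith
    calc (c + K * L) * IR * L ≤ ((2 * c + K) * L) * (132 * (L * I)) * L := by gcongr
      _ = _ := by ring
  have t3 : M * (5 * z) ≤ 20 * (A * (M * X)) := by
    have := mul_le_mul_of_nonneg_left hzAX hM
    have : 0 ≤ M * (A * X) := by positivity
    linarith
  rw [one_div, inv_mul_le_iff₀ hA0]
  refine hD.trans ?_
  calc _ = A * (58 * (1 + 2 * c ^ 2) * (M * η * P) +
        8 * (1 + 2 * c ^ 2) ^ 3 * P * ((c + K * L) * IR * L)) + M * (5 * z) := by ring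
    _ ≤ A * (58 * (1 + 2 * c ^ 2) * (4 * c * (M * X) + 8 * (P * L ^ 3 * I)) +
        8 * (1 + 2 * c ^ 2) ^ 3 * P * (132 * (2 * c + K) * (L ^ 3 * I))) +
        20 * (A * (M * X)) := by gcongr
    _ = _ := by ring

end PiatetskiShapiro

theorem mainTheorem1 (f : ℝ → ℝ) (hf : PiatetskiShapiro.Admissible f) :
    ∃ C : ℝ, 0 < C ∧ ∀ A₀ : ℝ, 2 ≤ A₀ → 1 ≤ deriv f A₀ →
      ∀ φ : ℕ → ℂ, (∀ n, ‖φ n‖ ≤ 1) → ∀ A : ℕ, A₀ ≤ (A : ℝ) → ∀ z : ℝ, 0 < z →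
        1 / (A : ℝ) *
            ‖(∑ n ∈ Finset.Ioc A (2 * A), φ ⌊f (n : ℝ)⌋₊) -
              ∑ m ∈ PiatetskiShapiro.intervalNat (f (A : ℝ)) (f (2 * (A : ℝ))),
                φ m * ((deriv (PiatetskiShapiro.inv f) (m : ℝ) : ℝ) : ℂ)‖ ≤
          C * (deriv (deriv f) (A : ℝ) / deriv f (A : ℝ) ^ 2 * z ^ 2 +
            deriv f (A : ℝ) * Real.log (A : ℝ) ^ 3 * PiatetskiShapiro.J f φ (A : ℝ) z) := by
  obtain ⟨c, hd⟩ := hf.exists_doubling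
  obtain ⟨K, hK, hKA⟩ := hd.exists_deriv_le_log_mul
  have hc := hd.one_le
  set C₁ := 232 * (1 + 2 * c ^ 2) * c + 20 with hC₁
  set C₂ := 464 * (1 + 2 * c ^ 2) + 1056 * (1 + 2 * c ^ 2) ^ 3 * (2 * c + K) with hC₂
  set C₃ := (3 + 2 * c ^ 2) * (8 * c + 16 + 8 * K) with hC₃
  refine ⟨C₁ + C₂ + C₃, by positivity, fun A₀ hA₀ hP₀ φ hφ A hA z hz => ?_⟩
  have hA2 : (2 : ℝ) ≤ A := hA₀.trans hA
  have hA0 : (0 : ℝ) < A := by linarith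
  have hA2' : 2 ≤ A := by exact_mod_cast hA2
  have hP : 1 ≤ deriv f A := hP₀.trans (hf.deriv_mono (by linarith) hA)
  have hQ := hf.deriv_deriv_pos A hA0
  have hfA := (hf.pos A hA0).le
  have hL := Real.log_nonneg (by linarith : (1 : ℝ) ≤ A)
  rw [hf.sub_eq_discrepancy (by omega) hP]
  -- the maximum of `|φ|` on the range
  obtain ⟨M, hM0, hM1, hφM, hMJ⟩ : ∃ M : ℝ, 0 ≤ M ∧ M ≤ 1 ∧
      (∀ m ∈ PiatetskiShapiro.intervalNat (f A) (f (2 * A)), ‖φ m‖ ≤ M) ∧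
      M / z ≤ PiatetskiShapiro.J f φ A z := by
    rcases (PiatetskiShapiro.intervalNat (f A) (f (2 * A))).eq_empty_or_nonempty with h | h
    · refine ⟨0, le_rfl, zero_le_one, by simp [h], ?_⟩
      rw [zero_div]
      exact intervalIntegral.integral_nonneg zero_le_one fun θ _ =>
        PiatetskiShapiro.windowSup_nonneg hz θ
    · obtain ⟨m, hm, hmax⟩ := Finset.exists_max_image _ (fun m => ‖φ m‖) h
      exact ⟨‖φ m‖, norm_nonneg _, hφ m, hmax, PiatetskiShapiro.norm_div_le_integral_windowSup
        hfA hz hφ hm (hf.pos _ (by linarith)).le⟩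
  set I := PiatetskiShapiro.J f φ A z with hI
  set X := deriv (deriv f) (A : ℝ) / deriv f (A : ℝ) ^ 2 * z ^ 2 with hX
  set Y := deriv f (A : ℝ) * Real.log (A : ℝ) ^ 3 with hY
  have hX0 : 0 ≤ X := by positivity
  have hY0 : 0 ≤ Y := by positivity
  have hI0 : 0 ≤ I := le_trans (by positivity) hMJ
  have hMX : M * X ≤ X := mul_le_of_le_one_left hX0 hM1
  have hYI : M * (Y / z) ≤ Y * I := by
    calc M * (Y / z) = Y * (M / z) := by ring
      _ ≤ _ := by gcongr
  have hC₁0 : 0 ≤ C₁ := by positivity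
  have hC₂0 : 0 ≤ C₂ := by positivity
  have hC₃0 : 0 ≤ C₃ := by positivity
  have hYI0 : 0 ≤ Y * I := by positivity
  by_cases hsmall : X ≤ 1 / (8 * c + 16 + 8 * K) ∧ Y / z ≤ 1 / (8 * c + 16 + 8 * K)
  · have := hd.norm_discrepancy_le_of_small hK hA2' hP (hKA A hA2) hφ hM0 hz hφM hI hMJ hsmall.1
      hsmall.2
    refine this.trans ?_
    calc C₁ * (M * X) + C₂ * (Y * I) ≤ C₁ * X + C₂ * (Y * I) := by gcongr
      _ ≤ _ := by nlinarith [mul_nonneg hC₁0 hYI0, mul_nonneg hC₂0 hX0, mul_nonneg hC₃0 hX0,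
                    mul_nonneg hC₃0 hYI0]
  -- otherwise the right-hand side exceeds a constant multiple of `M`
  · have hbig : 1 / (8 * c + 16 + 8 * K) ≤ X + Y / z := by
      have : 0 ≤ Y / z := by positivity
      by_contra hcon
      exact hsmall ⟨by linarith, by linarith⟩
    have h1 : 1 ≤ (8 * c + 16 + 8 * K) * (X + Y / z) := by
      rwa [div_le_iff₀' (by positivity)] at hbig
    calc _ ≤ (3 + 2 * c ^ 2) * M := hd.norm_discrepancy_le (by omega) hP hM0 hφM
      _ ≤ (3 + 2 * c ^ 2) * M * ((8 * c + 16 + 8 * K) * (X + Y / z)) :=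
          le_mul_of_one_le_right (by positivity) h1
      _ = C₃ * (M * X + M * (Y / z)) := by rw [hC₃]; ring
      _ ≤ C₃ * (X + Y * I) := by gcongr
      _ ≤ _ := by gcongr; linarith
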